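/- Let $N$ be a free $\mathbb Z$-module of finite rank with dual $M=\operatorname{Hom}(N,\mathbb Z)$, and let $\Sigma$ be a finite, not necessarily complete, rational fan in $N_{\mathbb R}=N\otimes\mathbb R$ (a finite set of strongly convex cones, each generated by finitely many elements of $N$, which contains all faces of its members and such that the intersection of any two members is a face of both). Order $\Sigma$ by the face relation. Let $k$ be one of the multiplicative monoids $\mathbb C$, $\mathbb R$, $\mathbb R_+=[0,\infty)$. For $\sigma\in\Sigma$ let $X_\sigma(k)=\operatorname{Hom}(\sigma^\vee\cap M,k)$ be the set of monoid homomorphisms with the topology of pointwise convergence, and let $X_\Sigma(k)$ be the toric variety obtained by gluing the $X_\sigma(k)$ along the restriction maps $X_\tau(k)\to X_\sigma(k)$, $\tau\le\sigma$. Let $T(k)=\operatorname{Hom}(M,k\cap S^1)$, which acts on $X_\sigma(k)$ by pointwise multiplication, let $T_\sigma(k)=\{t\in T(k): t(m)=1 \text{ for all } m\in\sigma^\perp\cap M\}$, and let $x_\sigma\in X_\sigma(k)$ be the distinguished point, with $x_\sigma(m)=1$ for $m\in\sigma^\perp$ and $x_\sigma(m)=0$ otherwise. Let $D_\Sigma(k)$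 be the diagram of spaces over the poset $\Sigma$ that assigns $T(k)/T_\sigma(k)$ to $\sigma$ and the projection $T(k)/T_\sigma(k)\to T(k)/T_\tau(k)$ to $\sigma\le\tau$. For a diagram $D$ of spaces over a finite poset $P$, let $$\operatorname{hocolim} D=\Bigl(\coprod_{p\in P}D(p)\times|\mathcal F(P_{\ge p})|\Bigr)\Big/\mathord\sim$$ be the standard construction of its homotopy colimit, where $|\mathcal F(Q)|$ is the geometric realization of the order complex of the poset $Q$, and where $\sim$ is generated by $(x,w)\sim(D(p\le q)(x),w)$ for $p\le q$, $x\in D(p)$ and $w\in|\mathcal F(P_{\ge q})|\subseteq|\mathcal F(P_{\ge p})|$. Then $X_\Sigma(k)$ is the homotopy colimit of $D_\Sigma(k)$: there is a homotopy equivalence $h\colon\operatorname{hocolim}D_\Sigma(k)\to X_\Sigma(k)$ whose composition with the canonical map $D_\Sigma(k)(\sigma)\to\operatorname{hocolim}D_\Sigma(k)$ (the inclusion over the vertex $\sigma$ of $|\mathcal F(\Sigma_{\ge\sigma})|$) is the orbit map $t\,T_\sigma(k)\mapsto t\cdot x_\sigma$, for every $\sigma\in\Sigma$. -/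

import Mathlib

open CategoryTheory
open scoped TensorProduct

/-! ## Homotopy colimits over finite posets -/

section HomotopyColimit

universe u v

/-- The geometric realization `|𝓕(P)|` of the order complex of a finite poset `P`, in barycentric
coordinates: the points of the standard simplex on the vertex set `P` whose support is a chain. -/
def OrderComplexRealization (P : Type v) [PartialOrder P] [Fintype P] : Type v :=
  {w : P → ℝ // w ∈ stdSimplex ℝ P ∧ IsChain (· ≤ ·) (Function.support w)}

instance (P : Type v) [PartialOrder P] [Fintype P] :
    TopologicalSpace (OrderComplexRealization P) :=
  inferInstanceAs (TopologicalSpace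
    {w : P → ℝ // w ∈ stdSimplex ℝ P ∧ IsChain (· ≤ ·) (Function.support w)})

/-- The closed subspace `|𝓕(P_{≥ p})|` of `|𝓕(P)|`. -/
def UpperRealization {P : Type v} [PartialOrder P] [Fintype P] (p : P) : Type v :=
  {w : OrderComplexRealization P // ∀ q : P, w.1 q ≠ 0 → p ≤ q}

instance {P : Type v} [PartialOrder P] [Fintype P] (p : P) :
    TopologicalSpace (UpperRealization p) :=
  inferInstanceAs (TopologicalSpace {w : OrderComplexRealization P // ∀ q : P, w.1 q ≠ 0 → p ≤ q})

/-- The vertex `p` of `|𝓕(P_{≥ p})|`. -/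
noncomputable def UpperRealization.vertex {P : Type v} [PartialOrder P] [Fintype P] (p : P) :
    UpperRealization p := by
  classical
  exact ⟨⟨Pi.single p 1, single_mem_stdSimplex ℝ p, by
      intro a ha b hb _
      have h : ∀ c : P, c ∈ Function.support (Pi.single p (1 : ℝ) : P → ℝ) → c = p := by
        intro c hc
        by_contra hne
        exact hc (Pi.single_eq_of_ne hne 1)
      rw [h a ha, h b hb]
      exact Or.inl le_rfl⟩, by
    intro q hq
    by_contra hle
    exact hq (Pi.single_eq_of_ne (fun h => hle (le_of_eq h.symm)) 1)⟩

/-- The inclusion `|𝓕(P_{≥ q})| ⊆ |𝓕(P_{≥ p})|` for `p ≤ q`. -/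
def UpperRealization.inclusion {P : Type v} [PartialOrder P] [Fintype P] {p q : P} (h : p ≤ q)
    (w : UpperRealization q) : UpperRealization p :=
  ⟨w.1, fun r hr => h.trans (w.2 r hr)⟩

/-- For `p ≤ q`, the point `(x, w)` of `D(p) × |𝓕(P_{≥ q})| ⊆ D(p) × |𝓕(P_{≥ p})|` is identified
with the point `(D(p ≤ q)(x), w)` of `D(q) × |𝓕(P_{≥ q})|`. -/
inductive HomotopyColimit.Rel {P : Type v} [PartialOrder P] [Fintype P] (D : P ⥤ TopCat.{u}) :
    (Σ p : P, D.obj p × UpperRealization p) → (Σ p : P, D.obj p × UpperRealization p) → Prop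
  | glue {p q : P} (h : p ≤ q) (x : D.obj p) (w : UpperRealization q) :
      HomotopyColimit.Rel D ⟨p, x, UpperRealization.inclusion h w⟩ ⟨q, D.map (homOfLE h) x, w⟩

/-- The standard construction of the homotopy colimit of a diagram of spaces `D` over a finite
poset `P`: the quotient of `∐_p D(p) × |𝓕(P_{≥ p})|` by the equivalence relation generated by
`HomotopyColimit.Rel`. -/
def HomotopyColimit {P : Type v} [PartialOrder P] [Fintype P] (D : P ⥤ TopCat.{u}) : Type _ :=
  Quot (HomotopyColimit.Rel D)

instance {P : Type v} [PartialOrder P] [Fintype P] (D : P ⥤ TopCat.{u}) :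
    TopologicalSpace (HomotopyColimit D) :=
  inferInstanceAs (TopologicalSpace (Quot (HomotopyColimit.Rel D)))

/-- The canonical map `D(p) → hocolim D`, which sends `x` to the class of `(x, p)`. -/
noncomputable def HomotopyColimit.ι {P : Type v} [PartialOrder P] [Fintype P] (D : P ⥤ TopCat.{u})
    (p : P) (x : D.obj p) : HomotopyColimit D :=
  Quot.mk _ ⟨p, x, UpperRealization.vertex p⟩

end HomotopyColimit

/-! ## Cones and fans -/

section Fans

universe u

/-- The linear form on `N_ℝ = ℝ ⊗ N` given by an element `m` of the dual lattice `M`. -/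
noncomputable def latticePairing {N : Type u} [AddCommGroup N] (m : Module.Dual ℤ N) :
    (ℝ ⊗[ℤ] N) →ₗ[ℝ] ℝ :=
  (TensorProduct.AlgebraTensorModule.rid ℤ ℝ ℝ).toLinearMap ∘ₗ LinearMap.baseChange ℝ m

theorem latticePairing_tmul {N : Type u} [AddCommGroup N] (m : Module.Dual ℤ N) (r : ℝ) (v : N) :
    latticePairing m (r ⊗ₜ v) = m v * r := by
  simp [latticePairing]

theorem latticePairing_zero {N : Type u} [AddCommGroup N] :
    latticePairing (0 : Module.Dual ℤ N) = 0 := by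
  simp [latticePairing]

theorem latticePairing_add {N : Type u} [AddCommGroup N] (m m' : Module.Dual ℤ N) :
    latticePairing (m + m') = latticePairing m + latticePairing m' := by
  simp [latticePairing, LinearMap.baseChange_add, LinearMap.comp_add]

/-- A rational (polyhedral) cone in `N_ℝ`: one generated by finitely many lattice vectors. -/
def IsRationalCone {N : Type u} [AddCommGroup N] (σ : PointedCone ℝ (ℝ ⊗[ℤ] N)) : Prop :=
  ∃ S : Finset N, σ = PointedCone.hull ℝ ((fun v : N => (1 : ℝ) ⊗ₜ[ℤ] v) '' (S : Set N))

/-- A (finite, not necessarily complete) rational fan in `N_ℝ`. -/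
structure RationalFan (N : Type u) [AddCommGroup N] where
  cones : Finset (PointedCone ℝ (ℝ ⊗[ℤ] N))
  rational : ∀ σ ∈ cones, IsRationalCone σ
  /-- The cones are strongly convex. -/
  salient : ∀ σ ∈ cones, (σ : ConvexCone ℝ (ℝ ⊗[ℤ] N)).Salient
  face_mem : ∀ σ ∈ cones, ∀ τ : PointedCone ℝ (ℝ ⊗[ℤ] N), τ.IsFaceOf σ → τ ∈ cones
  inter_face : ∀ σ ∈ cones, ∀ τ ∈ cones, (σ ⊓ τ).IsFaceOf σ ∧ (σ ⊓ τ).IsFaceOf τ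

/-- A fan as a poset. It is ordered by inclusion, which for two cones `τ`, `σ` of a fan means the
same as `τ` being a face of `σ`. -/
abbrev RationalFan.Cone {N : Type u} [AddCommGroup N] (F : RationalFan N) : Type u :=
  {σ : PointedCone ℝ (ℝ ⊗[ℤ] N) // σ ∈ F.cones}

theorem RationalFan.Cone.le_iff_isFaceOf {N : Type u} [AddCommGroup N] (F : RationalFan N)
    (τ σ : F.Cone) : τ ≤ σ ↔ τ.1.IsFaceOf σ.1 := by
  refine ⟨fun h => ?_, fun h => h.le⟩
  have h' := (F.inter_face σ.1 σ.2 τ.1 τ.2).1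
  rwa [inf_eq_right.2 (show τ.1 ≤ σ.1 from h)] at h'

/-- The monoid `σ^∨ ∩ M`. -/
def dualMonoid {N : Type u} [AddCommGroup N] (σ : PointedCone ℝ (ℝ ⊗[ℤ] N)) :
    AddSubmonoid (Module.Dual ℤ N) where
  carrier := {m | ∀ v ∈ σ, 0 ≤ latticePairing m v}
  zero_mem' := fun v _ => by simp [latticePairing_zero]
  add_mem' := fun {a b} ha hb v hv => by
    rw [latticePairing_add]
    exact add_nonneg (ha v hv) (hb v hv)

/-- The group `σ^⊥ ∩ M`. -/
def perpGroup {N : Type u} [AddCommGroup N] (σ : PointedCone ℝ (ℝ ⊗[ℤ] N)) :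
    AddSubgroup (Module.Dual ℤ N) where
  carrier := {m | ∀ v ∈ σ, latticePairing m v = 0}
  zero_mem' := fun v _ => by simp [latticePairing_zero]
  add_mem' := fun {a b} ha hb v hv => by
    rw [latticePairing_add, LinearMap.add_apply, ha v hv, hb v hv, add_zero]
  neg_mem' := fun {a} ha v hv => by
    have h := latticePairing_add a (-a)
    rw [add_neg_cancel, latticePairing_zero] at h
    have h' := LinearMap.congr_fun h v
    rw [LinearMap.add_apply, ha v hv, zero_add] at h'
    exact h'.symm

theorem dualMonoid_anti {N : Type u} [AddCommGroup N] {τ σ : PointedCone ℝ (ℝ ⊗[ℤ] N)}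
    (h : τ ≤ σ) : dualMonoid σ ≤ dualMonoid τ :=
  fun _ hm v hv => hm v (h hv)

theorem perpGroup_anti {N : Type u} [AddCommGroup N] {τ σ : PointedCone ℝ (ℝ ⊗[ℤ] N)}
    (h : τ ≤ σ) : perpGroup σ ≤ perpGroup τ :=
  fun _ hm v hv => hm v (h hv)

theorem add_mem_perpGroup_iff {N : Type u} [AddCommGroup N] {σ : PointedCone ℝ (ℝ ⊗[ℤ] N)}
    {a b : Module.Dual ℤ N} (ha : a ∈ dualMonoid σ) (hb : b ∈ dualMonoid σ) :
    a + b ∈ perpGroup σ ↔ a ∈ perpGroup σ ∧ b ∈ perpGroup σ := by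
  refine ⟨fun h => ?_, fun h => add_mem h.1 h.2⟩
  have key : ∀ v ∈ σ, latticePairing a v = 0 ∧ latticePairing b v = 0 := by
    intro v hv
    have h1 := ha v hv
    have h2 := hb v hv
    have h3 := h v hv
    rw [latticePairing_add, LinearMap.add_apply] at h3
    constructor <;> linarith
  exact ⟨fun v hv => (key v hv).1, fun v hv => (key v hv).2⟩

end Fans

/-! ## Toric varieties over a submonoid `k` of `ℂ` -/

section Toric

universe u

/-- The affine toric variety `X_σ(k) = Hom(σ^∨ ∩ M, k)` (monoid homomorphisms). -/
def AffineToric {N : Type u} [AddCommGroup N] (k : Submonoid ℂ)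
    (σ : PointedCone ℝ (ℝ ⊗[ℤ] N)) : Type u :=
  Multiplicative (dualMonoid σ) →* k

/-- A point of `X_σ(k)`, seen as a monoid homomorphism. -/
def AffineToric.toHom {N : Type u} [AddCommGroup N] {k : Submonoid ℂ}
    {σ : PointedCone ℝ (ℝ ⊗[ℤ] N)} (x : AffineToric k σ) : Multiplicative (dualMonoid σ) →* k :=
  x

/-- The value `x(m)` for `x ∈ X_σ(k)` and `m ∈ σ^∨ ∩ M`, as a complex number. -/
def AffineToric.val {N : Type u} [AddCommGroup N] {k : Submonoid ℂ}
    {σ : PointedCone ℝ (ℝ ⊗[ℤ] N)} (x : AffineToric k σ) (m : dualMonoid σ) : ℂ :=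
  (x.toHom (Multiplicative.ofAdd m) : ℂ)

/-- `X_σ(k)` has the topology of pointwise convergence. Since values at all of `σ^∨ ∩ M` are
monomials in the values at a finite generating set `L`, this is the subspace topology from `k^L`. -/
noncomputable instance {N : Type u} [AddCommGroup N] (k : Submonoid ℂ) (σ : PointedCone ℝ (ℝ ⊗[ℤ] N)) :
    TopologicalSpace (AffineToric k σ) :=
  TopologicalSpace.induced AffineToric.val Pi.topologicalSpace

/-- The map `X_τ(k) → X_σ(k)` for `τ ≤ σ`, by restriction of homomorphisms. -/
def AffineToric.restrict {N : Type u} [AddCommGroup N] {k : Submonoid ℂ}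
    {τ σ : PointedCone ℝ (ℝ ⊗[ℤ] N)} (h : τ ≤ σ) (x : AffineToric k τ) : AffineToric k σ :=
  MonoidHom.comp x (AddMonoidHom.toMultiplicative (AddSubmonoid.inclusion (dualMonoid_anti h)))

/-- For `τ ≤ σ`, a point of `X_τ(k)` is identified with its image in `X_σ(k)`. -/
inductive RationalFan.Glue {N : Type u} [AddCommGroup N] (F : RationalFan N) (k : Submonoid ℂ) :
    (Σ σ : F.Cone, AffineToric k σ.1) → (Σ σ : F.Cone, AffineToric k σ.1) → Prop
  | glue {τ σ : F.Cone} (h : τ ≤ σ) (x : AffineToric k τ.1) :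
      RationalFan.Glue F k ⟨τ, x⟩ ⟨σ, AffineToric.restrict h x⟩

/-- The toric variety `X_Σ(k)`, obtained by gluing the affine pieces `X_σ(k)`, `σ ∈ Σ`. -/
def RationalFan.ToricVariety {N : Type u} [AddCommGroup N] (F : RationalFan N)
    (k : Submonoid ℂ) : Type u :=
  Quot (RationalFan.Glue F k)

instance {N : Type u} [AddCommGroup N] (F : RationalFan N) (k : Submonoid ℂ) :
    TopologicalSpace (F.ToricVariety k) :=
  inferInstanceAs (TopologicalSpace (Quot (RationalFan.Glue F k)))

/-- The group `𝕋(k) = Hom(M, k) = Hom(M, kˣ)`. -/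
def AlgTorus (N : Type u) [AddCommGroup N] (k : Submonoid ℂ) : Type u :=
  Multiplicative (Module.Dual ℤ N) →* kˣ

noncomputable instance (N : Type u) [AddCommGroup N] (k : Submonoid ℂ) : CommGroup (AlgTorus N k) :=
  inferInstanceAs (CommGroup (Multiplicative (Module.Dual ℤ N) →* kˣ))

/-- An element of `𝕋(k)`, seen as a group homomorphism. -/
def AlgTorus.toHom {N : Type u} [AddCommGroup N] {k : Submonoid ℂ} (t : AlgTorus N k) :
    Multiplicative (Module.Dual ℤ N) →* kˣ :=
  t

/-- The value `t(m)` for `t ∈ 𝕋(k)` and `m ∈ M`, as an element of `k`. -/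
def AlgTorus.val {N : Type u} [AddCommGroup N] {k : Submonoid ℂ} (t : AlgTorus N k)
    (m : Module.Dual ℤ N) : k :=
  (t.toHom (Multiplicative.ofAdd m) : kˣ)

/-- The topology of pointwise convergence on `𝕋(k)`. -/
noncomputable instance (N : Type u) [AddCommGroup N] (k : Submonoid ℂ) : TopologicalSpace (AlgTorus N k) :=
  TopologicalSpace.induced (fun t m => (t.val m : ℂ)) Pi.topologicalSpace

/-- The group `T(k) = 𝕋(k ∩ S¹)`. -/
abbrev CompactTorus (N : Type u) [AddCommGroup N] (k : Submonoid ℂ) : Type u :=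
  AlgTorus N (k ⊓ Submonoid.unitSphere ℂ)

/-- The subgroup `T_σ(k) = {t ∈ T(k) : σ^⊥ ∩ M ⊆ ker t}` of `T(k)`. -/
noncomputable def isotropySubgroup {N : Type u} [AddCommGroup N] (k : Submonoid ℂ)
    (σ : PointedCone ℝ (ℝ ⊗[ℤ] N)) : Subgroup (CompactTorus N k) where
  carrier := {t | ∀ m ∈ perpGroup σ, t.toHom (Multiplicative.ofAdd m) = 1}
  one_mem' := fun _ _ => rfl
  mul_mem' := fun {a b} ha hb m hm => by
    change a.toHom (Multiplicative.ofAdd m) * b.toHom (Multiplicative.ofAdd m)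
      = 1
    rw [ha m hm, hb m hm, one_mul]
  inv_mem' := fun {a} ha m hm => by
    change (a.toHom (Multiplicative.ofAdd m))⁻¹ = 1
    rw [ha m hm, inv_one]

theorem isotropySubgroup_mono {N : Type u} [AddCommGroup N] (k : Submonoid ℂ)
    {σ τ : PointedCone ℝ (ℝ ⊗[ℤ] N)} (h : σ ≤ τ) :
    isotropySubgroup k σ ≤ isotropySubgroup k τ :=
  fun _ ht m hm => ht m (perpGroup_anti h hm)

/-- The projection `T(k)/T_σ(k) → T(k)/T_τ(k)` for `σ ≤ τ`. -/
noncomputable def orbitProjection {N : Type u} [AddCommGroup N] (k : Submonoid ℂ)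
    {σ τ : PointedCone ℝ (ℝ ⊗[ℤ] N)} (h : σ ≤ τ) :
    C(CompactTorus N k ⧸ isotropySubgroup k σ, CompactTorus N k ⧸ isotropySubgroup k τ) where
  toFun := QuotientGroup.map _ _ (MonoidHom.id _) (isotropySubgroup_mono k h)
  continuous_toFun :=
    continuous_quot_lift _ (continuous_quot_mk (X := CompactTorus N k))

/-- The diagram of spaces `D_Σ(k)`: it assigns `T(k)/T_σ(k)` to `σ` and the projection
`T(k)/T_σ(k) → T(k)/T_τ(k)` to `σ ≤ τ`. -/
noncomputable def RationalFan.diagram {N : Type u} [AddCommGroup N] (F : RationalFan N) (k : Submonoid ℂ) :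
    F.Cone ⥤ TopCat.{u} where
  obj σ := TopCat.of (CompactTorus N k ⧸ isotropySubgroup k σ.1)
  map {σ τ} f := TopCat.ofHom (orbitProjection k (show σ.1 ≤ τ.1 from leOfHom f))
  map_id σ := by
    ext x
    induction x using QuotientGroup.induction_on
    rfl
  map_comp f g := by
    ext x
    induction x using QuotientGroup.induction_on
    rfl

open Classical in
/-- The distinguished point `x_σ ∈ X_σ(k)`, which is `1` on `σ^⊥ ∩ M` and `0` elsewhere. -/
noncomputable def distinguishedPoint {N : Type u} [AddCommGroup N] {k : Submonoid ℂ}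
    (h0 : (0 : ℂ) ∈ k) (σ : PointedCone ℝ (ℝ ⊗[ℤ] N)) : AffineToric k σ :=
  show Multiplicative (dualMonoid σ) →* k from
  { toFun := fun m => if (m.toAdd : Module.Dual ℤ N) ∈ perpGroup σ then 1 else ⟨0, h0⟩
    map_one' := if_pos (zero_mem (perpGroup σ))
    map_mul' := fun a b => by
      have key := add_mem_perpGroup_iff a.toAdd.2 b.toAdd.2
      rw [toAdd_mul, AddSubmonoid.coe_add]
      by_cases ha : (a.toAdd : Module.Dual ℤ N) ∈ perpGroup σ
      · by_cases hb : (b.toAdd : Module.Dual ℤ N) ∈ perpGroup σ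
        · rw [if_pos (key.2 ⟨ha, hb⟩), if_pos ha, if_pos hb, one_mul]
        · rw [if_neg (fun h => hb (key.1 h).2), if_pos ha, if_neg hb, one_mul]
      · rw [if_neg (fun h => ha (key.1 h).1), if_neg ha]
        exact Subtype.ext (zero_mul _).symm }

/-- The action of `T(k)` on `X_σ(k)` by pointwise multiplication of functions. -/
noncomputable instance {N : Type u} [AddCommGroup N] (k : Submonoid ℂ) (σ : PointedCone ℝ (ℝ ⊗[ℤ] N)) :
    SMul (CompactTorus N k) (AffineToric k σ) where
  smul t x := show Multiplicative (dualMonoid σ) →* k from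
    { toFun := fun m => ⟨t.val m.toAdd, (t.val m.toAdd).2.1⟩ * x.toHom m
      map_one' := by
        refine Subtype.ext ?_
        have h1 : t.val (0 : Module.Dual ℤ N) = 1 := congrArg Units.val (t.toHom.map_one)
        have h2 : x.toHom 1 = 1 := x.toHom.map_one
        simp [h1, h2]
      map_mul' := fun a b => by
        refine Subtype.ext ?_
        have h1 : t.val ((a.toAdd : Module.Dual ℤ N) + b.toAdd) = t.val a.toAdd * t.val b.toAdd :=
          congrArg Units.val (t.toHom.map_mul (Multiplicative.ofAdd (a.toAdd : Module.Dual ℤ N))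
            (Multiplicative.ofAdd (b.toAdd : Module.Dual ℤ N)))
        have h2 : x.toHom (a * b) = x.toHom a * x.toHom b :=
          x.toHom.map_mul a b
        simp only [toAdd_mul, AddSubmonoid.coe_add, h1, h2, Submonoid.coe_mul]
        ring }

/-- The map `T(k) → X_Σ(k)`, `t ↦ t · x_σ`, for `σ ∈ Σ`. -/
noncomputable def RationalFan.orbitMap {N : Type u} [AddCommGroup N] (F : RationalFan N)
    {k : Submonoid ℂ} (h0 : (0 : ℂ) ∈ k) (σ : F.Cone) (t : CompactTorus N k) :
    F.ToricVariety k :=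
  Quot.mk _ ⟨σ, t • distinguishedPoint h0 σ.1⟩

end Toric

/-! ## Rational Farkas lemma and separation of cones -/

section Farkas

/-! A point of $X_\Sigma$ lies on the orbit of one cone $\sigma$ and has a phase, well defined in
$T/T_\sigma$. What remains is its absolute values, which carry no more homotopy information than a
position in $|\mathcal F(\Sigma_{\ge\sigma})|$. The proof makes this explicit with two maps and two
homotopies.

From the homotopy colimit: `torusMap` sends $(t,w)$ to $m\mapsto t(m)\prod_\tau(1-w_\tau/\max
w)^{\langle m,v_\tau\rangle}$, where $v_\tau$ is a lattice vector in the relative interior of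
$\tau$. At least one factor $1-w_\tau/\max w$ is zero. Hence, if $p$ lies below the support of $w$,
every monomial outside $p^\perp$ vanishes (`damping_factor_one_eq_zero`), so that $t$ matters only
modulo $T_p$. At the vertex $\sigma$ the value is $t\cdot x_\sigma$ (`torusMap_vertex`).

Back: separating functionals of pairs of cones give continuous weights $W_\tau\ge 0$ on $X_\Sigma$
which are positive exactly on $X_\tau$ (`continuous_weight`). As $s$ grows, the sets $\{\tau :
W_\tau>s\}$ shrink and their meets run up a chain of cones; the normalized lengths of the intervals
of $s$ with a given meet are barycentric coordinates (`toChain`). With the phase they give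
`toHocolim`.

Going from the homotopy colimit and back keeps the phase and moves only the coordinate in the order
complex, within each $|\mathcal F(\Sigma_{\ge p})|$; mixing weights and then a straight segment
connect this to the identity. The other composition is the end of the flow which multiplies $x$ by
$|x|^{-s}$ and by the monomial with factors $1-s\,w_\tau/\max w$. The flow is continuous because the
damping vanishes where $x|x|^{-1}$ is singular (`continuous_mul_rpow_neg_mul`). -/

theorem exists_nonneg_sum_of_forall_nonpos {K W ι : Type*} [Field K] [LinearOrder K]
    [IsStrictOrderedRing K] [AddCommGroup W] [Module K W] (s : Finset ι) :
    ∀ (a : ι → W →ₗ[K] K) (b : W →ₗ[K] K),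
      (∀ x, (∀ i ∈ s, a i x ≤ 0) → b x ≤ 0) →
      ∃ c : ι → K, (∀ i, 0 ≤ c i) ∧ b = ∑ i ∈ s, c i • a i := by
  classical
  induction s using Finset.induction_on with
  | empty =>
    intro a b h
    refine ⟨0, fun _ => le_rfl, ?_⟩
    ext x
    have h1 := h x (by simp)
    have h2 := h (-x) (by simp)
    rw [map_neg] at h2
    simp only [Finset.sum_empty, LinearMap.zero_apply]
    linarith
  | insert j s hj ih =>
    intro a b h
    by_cases hb : ∀ x, (∀ i ∈ s, a i x ≤ 0) → b x ≤ 0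
    · obtain ⟨c, hc, hbc⟩ := ih a b hb
      refine ⟨Function.update c j 0, fun i => ?_, ?_⟩
      · by_cases hi : i = j
        · simp [hi]
        · simp [hi, hc i]
      · rw [Finset.sum_insert hj, hbc]
        simp only [Function.update_self, zero_smul, zero_add]
        refine Finset.sum_congr rfl fun i hi => ?_
        rw [Function.update_of_ne (ne_of_mem_of_not_mem hi hj)]
    · push Not at hb
      obtain ⟨x₀, hx₀, hbx₀⟩ := hb
      have hj0 : 0 < a j x₀ := by
        by_contra hle
        refine absurd (h x₀ fun i hi => ?_) (not_le.2 hbx₀)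
        rcases Finset.mem_insert.1 hi with rfl | hi
        · exact not_lt.1 hle
        · exact hx₀ i hi
      -- Subtracting these multiples of `a j` is composing with the projection onto the kernel of `a
      -- j` along `x₀`, which removes the constraint `j`. The coefficient of `a j` restored
      -- afterwards is nonnegative because `b x₀ > 0` and `a i x₀ ≤ 0` for `i ∈ s`.
      obtain ⟨c, hc, hbc⟩ := ih (fun i => a i - (a i x₀ / a j x₀) • a j)
        (b - (b x₀ / a j x₀) • a j) (by
          intro x hx
          have key := h (x - (a j x / a j x₀) • x₀) (by
            intro i hi
            rcases Finset.mem_insert.1 hi with rfl | hi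
            · simp [div_mul_cancel₀ _ hj0.ne']
            · have := hx i hi
              simp only [LinearMap.sub_apply, LinearMap.smul_apply, smul_eq_mul, map_sub,
                map_smul] at this ⊢
              calc _ = a i x - a i x₀ / a j x₀ * a j x := by ring
                _ ≤ 0 := this)
          simp only [LinearMap.sub_apply, LinearMap.smul_apply, smul_eq_mul, map_sub,
            map_smul] at key ⊢
          calc _ = b x - a j x / a j x₀ * b x₀ := by ring
            _ ≤ 0 := key)
      refine ⟨Function.update c j (b x₀ / a j x₀ - ∑ i ∈ s, c i * (a i x₀ / a j x₀)),
        fun i => ?_, ?_⟩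
      · by_cases hi : i = j
        · subst hi
          simp only [Function.update_self]
          have h1 : 0 < b x₀ / a i x₀ := div_pos hbx₀ hj0
          have h2 : ∑ l ∈ s, c l * (a l x₀ / a i x₀) ≤ 0 :=
            Finset.sum_nonpos fun l hl => mul_nonpos_of_nonneg_of_nonpos (hc l)
              (div_nonpos_of_nonpos_of_nonneg (hx₀ l hl) hj0.le)
          linarith
        · simp [hi, hc i]
      · rw [Finset.sum_insert hj, Function.update_self]
        have h3 : ∑ i ∈ s, Function.update c j
            (b x₀ / a j x₀ - ∑ i ∈ s, c i * (a i x₀ / a j x₀)) i • a i = ∑ i ∈ s, c i • a i :=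
          Finset.sum_congr rfl fun i hi => by
            rw [Function.update_of_ne (ne_of_mem_of_not_mem hi hj)]
        rw [h3]
        ext x
        have h4 := LinearMap.congr_fun hbc x
        simp only [LinearMap.sub_apply, LinearMap.smul_apply, LinearMap.sum_apply,
          LinearMap.add_apply, smul_eq_mul, mul_sub, Finset.sum_sub_distrib, sub_mul,
          Finset.sum_mul] at h4 ⊢
        simp only [mul_assoc]
        linarith

end Farkas

section Separation

universe u

variable {N : Type u} [AddCommGroup N]

theorem latticePairing_neg (m : Module.Dual ℤ N) : latticePairing (-m) = -latticePairing m := by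
  have h := latticePairing_add m (-m)
  rw [add_neg_cancel, latticePairing_zero] at h
  exact (neg_eq_of_add_eq_zero_right h.symm).symm

theorem latticePairing_nsmul (n : ℕ) (m : Module.Dual ℤ N) :
    latticePairing (n • m) = n • latticePairing m := by
  induction n with
  | zero => simp [latticePairing_zero]
  | succ n ih => rw [succ_nsmul, latticePairing_add, ih, succ_nsmul]

theorem latticePairing_sum {ι : Type*} (s : Finset ι) (f : ι → Module.Dual ℤ N) :
    latticePairing (∑ i ∈ s, f i) = ∑ i ∈ s, latticePairing (f i) := by
  classical
  induction s using Finset.induction_on with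
  | empty => simp [latticePairing_zero]
  | insert a s ha ih => rw [Finset.sum_insert ha, Finset.sum_insert ha, latticePairing_add, ih]

theorem latticePairing_one_tmul (m : Module.Dual ℤ N) (v : N) :
    latticePairing m ((1 : ℝ) ⊗ₜ v) = m v := by
  rw [latticePairing_tmul, mul_one]

/-- The real cone spanned by finitely many lattice vectors. -/
noncomputable def latticeCone (S : Finset N) : PointedCone ℝ (ℝ ⊗[ℤ] N) :=
  PointedCone.hull ℝ ((fun v : N => (1 : ℝ) ⊗ₜ[ℤ] v) '' (S : Set N))

theorem one_tmul_mem_latticeCone {S : Finset N} {v : N} (hv : v ∈ S) :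
    (1 : ℝ) ⊗ₜ[ℤ] v ∈ latticeCone S :=
  Submodule.subset_span ⟨v, hv, rfl⟩

theorem mem_latticeCone_iff {S : Finset N} {x : ℝ ⊗[ℤ] N} :
    x ∈ latticeCone S ↔ ∃ c : N → ℝ, (∀ v, 0 ≤ c v) ∧ x = ∑ v ∈ S, c v • ((1 : ℝ) ⊗ₜ[ℤ] v) := by
  constructor
  · intro hx
    induction hx using Submodule.span_induction with
    | mem x hx =>
      obtain ⟨v, hv, rfl⟩ := hx
      classical
      refine ⟨Pi.single v 1, fun w => ?_, ?_⟩
      · by_cases h : w = v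
        · subst h; simp
        · simp [h]
      · rw [Finset.sum_eq_single_of_mem v hv fun w _ hw => by simp [hw]]
        simp
    | zero => exact ⟨0, fun _ => le_rfl, by simp⟩
    | add x y _ _ hx hy =>
      obtain ⟨c, hc, rfl⟩ := hx
      obtain ⟨d, hd, rfl⟩ := hy
      refine ⟨c + d, fun v => add_nonneg (hc v) (hd v), ?_⟩
      simp [add_smul, Finset.sum_add_distrib]
    | smul a x _ hx =>
      obtain ⟨c, hc, rfl⟩ := hx
      refine ⟨fun v => a * c v, fun v => mul_nonneg a.2 (hc v), ?_⟩
      change (a : ℝ) • ∑ v ∈ S, c v • ((1 : ℝ) ⊗ₜ[ℤ] v) = _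
      rw [Finset.smul_sum]
      exact Finset.sum_congr rfl fun v _ => (mul_smul _ _ _).symm
  · rintro ⟨c, hc, rfl⟩
    exact Submodule.sum_mem _ fun v hv =>
      Submodule.smul_mem _ (⟨c v, hc v⟩ : {r : ℝ // 0 ≤ r}) (one_tmul_mem_latticeCone hv)

theorem latticePairing_nonneg_of_forall {S : Finset N} {m : Module.Dual ℤ N}
    (h : ∀ v ∈ S, 0 ≤ m v) {x : ℝ ⊗[ℤ] N} (hx : x ∈ latticeCone S) : 0 ≤ latticePairing m x := by
  obtain ⟨c, hc, rfl⟩ := mem_latticeCone_iff.1 hx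
  rw [map_sum]
  refine Finset.sum_nonneg fun v hv => ?_
  rw [map_smul, latticePairing_one_tmul]
  exact mul_nonneg (hc v) (by exact_mod_cast h v hv)

/-- The sum of the generators serves: a functional that is nonnegative on each generator and
vanishes on the sum vanishes on each of them. These vectors supply the exponents in `damping`. -/
theorem IsRationalCone.exists_interior_vector {σ : PointedCone ℝ (ℝ ⊗[ℤ] N)}
    (hσ : IsRationalCone σ) :
    ∃ v : N, (1 : ℝ) ⊗ₜ[ℤ] v ∈ σ ∧ ∀ m ∈ dualMonoid σ, m v = 0 → m ∈ perpGroup σ := by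
  obtain ⟨S, rfl⟩ := hσ
  change ∃ v : N, (1 : ℝ) ⊗ₜ[ℤ] v ∈ latticeCone S ∧
    ∀ m ∈ dualMonoid (latticeCone S), m v = 0 → m ∈ perpGroup (latticeCone S)
  refine ⟨∑ s ∈ S, s, ?_, ?_⟩
  · rw [TensorProduct.tmul_sum]
    exact Submodule.sum_mem _ fun s hs => one_tmul_mem_latticeCone hs
  · intro m hm h0 x hx
    have hnn : ∀ s ∈ S, 0 ≤ m s := fun s hs => by
      have := hm _ (one_tmul_mem_latticeCone hs)
      rw [latticePairing_one_tmul] at this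
      exact_mod_cast this
    rw [map_sum] at h0
    have h1 := (Finset.sum_eq_zero_iff_of_nonneg hnn).1 h0
    obtain ⟨c, hc, rfl⟩ := mem_latticeCone_iff.1 hx
    rw [map_sum]
    refine Finset.sum_eq_zero fun v hv => ?_
    rw [map_smul, latticePairing_one_tmul, h1 v hv]
    simp

variable [Module.Free ℤ N]

theorem one_tmul_eq_of_forall_pairing {x y : ℝ ⊗[ℤ] N}
    (h : ∀ m : Module.Dual ℤ N, latticePairing m x = latticePairing m y) : x = y := by
  classical
  let b := Module.Free.chooseBasis ℤ N
  let B := Algebra.TensorProduct.basis ℝ b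
  refine B.ext_elem fun i => ?_
  have key : ∀ z, B.repr z i = latticePairing (b.coord i) z := by
    intro z
    have : (Finsupp.lapply i ∘ₗ B.repr.toLinearMap : (ℝ ⊗[ℤ] N) →ₗ[ℝ] ℝ)
        = latticePairing (b.coord i) := by
      refine B.ext fun j => ?_
      simp only [LinearMap.comp_apply, LinearEquiv.coe_coe, B,
        Algebra.TensorProduct.basis_apply, latticePairing_one_tmul]
      simp [Finsupp.single_apply]
    exact LinearMap.congr_fun this z
  rw [key, key, h]

variable [Module.Finite ℤ N]

/-- An element of `Hom(N, ℚ)` has a positive integral multiple. -/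
theorem exists_nat_smul_eq_intCast (f : N →ₗ[ℤ] ℚ) :
    ∃ (n : ℕ) (m : Module.Dual ℤ N), 0 < n ∧ ∀ v, (m v : ℚ) = n * f v := by
  classical
  let b := Module.Free.chooseBasis ℤ N
  let n : ℕ := ∏ i, (f (b i)).den
  have hn : 0 < n := Finset.prod_pos fun i _ => (f (b i)).den_pos
  have hd : ∀ i, ∃ z : ℤ, (z : ℚ) = n * f (b i) := by
    intro i
    obtain ⟨e, he⟩ : (f (b i)).den ∣ n := Finset.dvd_prod_of_mem _ (Finset.mem_univ i)
    refine ⟨e * (f (b i)).num, ?_⟩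
    rw [he]
    push_cast
    have := Rat.den_mul_eq_num (f (b i))
    rw [mul_comm ((f (b i)).den : ℚ), mul_assoc, this]
  choose z hz using hd
  refine ⟨n, b.constr ℤ z, hn, fun v => ?_⟩
  have h : (Int.castAddHom ℚ).toIntLinearMap ∘ₗ (b.constr ℤ z) = (n : ℤ) • f := by
    refine b.ext fun i => ?_
    simp [hz i]
  have := LinearMap.congr_fun h v
  simpa using this

/-- Farkas' lemma for lattice cones, with an integral separating functional. -/
theorem exists_dual_neg_of_not_mem {S : Finset N} {v : N}
    (hv : (1 : ℝ) ⊗ₜ[ℤ] v ∉ latticeCone S) :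
    ∃ m : Module.Dual ℤ N, (∀ s ∈ S, 0 ≤ m s) ∧ m v < 0 := by
  by_contra hcon
  push Not at hcon
  -- Farkas is applied on $\operatorname{Hom}(N,\mathbb Q)$ to the evaluations at the vectors of `S`
  -- and at `v`. Working over $\mathbb Q$ allows test functionals to be cleared of denominators, so
  -- that only integral ones need to be considered.
  obtain ⟨c, hc, hb⟩ := exists_nonneg_sum_of_forall_nonpos (K := ℚ) (W := N →ₗ[ℤ] ℚ) S
    (fun s => LinearMap.applyₗ' ℚ s) (LinearMap.applyₗ' ℚ v) (by
      intro f hf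
      obtain ⟨n, m, hn, hm⟩ := exists_nat_smul_eq_intCast f
      have hn' : (0 : ℚ) < n := by exact_mod_cast hn
      have h1 := hcon (-m) (fun s hs => by
        have h2 : f s ≤ 0 := hf s hs
        have h3 : (m s : ℚ) ≤ 0 := by rw [hm]; exact mul_nonpos_of_nonneg_of_nonpos hn'.le h2
        have h4 : m s ≤ 0 := by exact_mod_cast h3
        simpa using h4)
      have h2 : m v ≤ 0 := by simpa using h1
      have h3 : (m v : ℚ) ≤ 0 := by exact_mod_cast h2
      rw [hm] at h3
      change f v ≤ 0
      by_contra h4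
      exact absurd h3 (not_le.2 (mul_pos hn' (not_le.1 h4))))
  refine hv (mem_latticeCone_iff.2 ⟨fun s => (c s : ℝ), fun s => Rat.cast_nonneg.2 (hc s), ?_⟩)
  refine one_tmul_eq_of_forall_pairing fun m => ?_
  have h1 := LinearMap.congr_fun hb ((Int.castAddHom ℚ).toIntLinearMap ∘ₗ m)
  have h2 : (m v : ℚ) = ∑ s ∈ S, c s * (m s : ℚ) := by
    simpa [LinearMap.sum_apply] using h1
  rw [map_sum, latticePairing_one_tmul]
  simp only [map_smul, latticePairing_one_tmul, smul_eq_mul]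
  exact_mod_cast congrArg (fun q : ℚ => (q : ℝ)) h2

/-- A lattice cone has an integral supporting functional which vanishes only on its lineality
space. -/
theorem exists_dual_support (S : Finset N) :
    ∃ m : Module.Dual ℤ N, (∀ s ∈ S, 0 ≤ m s) ∧
      ∀ x ∈ latticeCone S, latticePairing m x = 0 → -x ∈ latticeCone S := by
  classical
  have h : ∀ s : N, ∃ m : Module.Dual ℤ N, (∀ r ∈ S, 0 ≤ m r) ∧
      ((1 : ℝ) ⊗ₜ[ℤ] (-s) ∉ latticeCone S → 0 < m s) := by
    intro s
    by_cases hs : (1 : ℝ) ⊗ₜ[ℤ] (-s) ∈ latticeCone S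
    · exact ⟨0, by simp, fun h => absurd hs h⟩
    · obtain ⟨m, hm, hms⟩ := exists_dual_neg_of_not_mem hs
      exact ⟨m, hm, fun _ => by simpa using hms⟩
  choose f hf hf' using h
  -- The sum is positive at every generator `v` with `-v` outside the cone. If it vanishes on a
  -- combination of generators, only generators whose negatives lie in the cone can occur.
  refine ⟨∑ s ∈ S, f s, fun r hr => ?_, ?_⟩
  · rw [LinearMap.sum_apply]
    exact Finset.sum_nonneg fun s _ => hf s r hr
  · intro x hx hx0
    obtain ⟨c, hc, rfl⟩ := mem_latticeCone_iff.1 hx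
    rw [← Finset.sum_neg_distrib]
    refine Submodule.sum_mem _ fun v hv => ?_
    rw [map_sum] at hx0
    have hnn : ∀ w ∈ S, 0 ≤ latticePairing (∑ s ∈ S, f s) (c w • ((1 : ℝ) ⊗ₜ[ℤ] w)) := by
      intro w hw
      rw [map_smul, latticePairing_one_tmul, LinearMap.sum_apply]
      refine mul_nonneg (hc w) ?_
      exact_mod_cast Finset.sum_nonneg fun s _ => hf s w hw
    have h0 := (Finset.sum_eq_zero_iff_of_nonneg hnn).1 hx0 v hv
    rw [map_smul, latticePairing_one_tmul, smul_eq_mul, mul_eq_zero] at h0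
    by_cases hneg : (1 : ℝ) ⊗ₜ[ℤ] (-v) ∈ latticeCone S
    · have : -(c v • ((1 : ℝ) ⊗ₜ[ℤ] v)) = c v • ((1 : ℝ) ⊗ₜ[ℤ] (-v)) := by
        rw [TensorProduct.tmul_neg, smul_neg]
      rw [this]
      exact Submodule.smul_mem _ (⟨c v, hc v⟩ : {r : ℝ // 0 ≤ r}) hneg
    · have hpos : 0 < (∑ s ∈ S, f s) v := by
        rw [LinearMap.sum_apply]
        exact Finset.sum_pos' (fun s _ => hf s v hv) ⟨v, hv, hf' v hneg⟩
      have hcv : c v = 0 := h0.resolve_right (by exact_mod_cast hpos.ne')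
      rw [hcv]
      simp

/-- Separation of two rational cones which meet in a common face. -/
theorem exists_separating {σ τ : PointedCone ℝ (ℝ ⊗[ℤ] N)} (hσ : IsRationalCone σ)
    (hτ : IsRationalCone τ) (h : (σ ⊓ τ).IsFaceOf σ) :
    ∃ m : Module.Dual ℤ N, -m ∈ dualMonoid σ ∧ m ∈ dualMonoid τ ∧
      ∀ v ∈ σ, latticePairing m v = 0 → v ∈ τ := by
  classical
  obtain ⟨S, rfl⟩ := hσ
  obtain ⟨R, rfl⟩ := hτ
  change (latticeCone S ⊓ latticeCone R).IsFaceOf (latticeCone S) at h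
  change ∃ m : Module.Dual ℤ N, -m ∈ dualMonoid (latticeCone S) ∧ m ∈ dualMonoid (latticeCone R) ∧
      ∀ v ∈ latticeCone S, latticePairing m v = 0 → v ∈ latticeCone R
  -- The union generates the difference cone $\sigma-\tau$; a functional that is nonnegative there
  -- is nonnegative on $\sigma$ and nonpositive on $\tau$.
  obtain ⟨m, hm, hm'⟩ := exists_dual_support (S ∪ R.image Neg.neg)
  have hS : latticeCone S ≤ latticeCone (S ∪ R.image Neg.neg) :=
    Submodule.span_mono (Set.image_mono (by simp))
  have hdec : ∀ x ∈ latticeCone (S ∪ R.image Neg.neg),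
      ∃ s ∈ latticeCone S, ∃ r ∈ latticeCone R, x = s - r := by
    intro x hx
    induction hx using Submodule.span_induction with
    | mem x hx =>
      obtain ⟨v, hv, rfl⟩ := hx
      rcases Finset.mem_union.1 (Finset.mem_coe.1 hv) with hv | hv
      · exact ⟨_, one_tmul_mem_latticeCone hv, 0, zero_mem _, by simp⟩
      · obtain ⟨r, hr, rfl⟩ := Finset.mem_image.1 hv
        exact ⟨0, zero_mem _, _, one_tmul_mem_latticeCone hr, by simp [TensorProduct.tmul_neg]⟩
    | zero => exact ⟨0, zero_mem _, 0, zero_mem _, by simp⟩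
    | add x y _ _ hx hy =>
      obtain ⟨s, hs, r, hr, rfl⟩ := hx
      obtain ⟨s', hs', r', hr', rfl⟩ := hy
      exact ⟨s + s', add_mem hs hs', r + r', add_mem hr hr', by abel⟩
    | smul a x _ hx =>
      obtain ⟨s, hs, r, hr, rfl⟩ := hx
      exact ⟨a • s, Submodule.smul_mem _ a hs, a • r, Submodule.smul_mem _ a hr,
        smul_sub (a : ℝ) s r⟩
  refine ⟨-m, ?_, ?_, ?_⟩
  · intro v hv
    rw [neg_neg]
    exact latticePairing_nonneg_of_forall (fun s hs => hm s (by simp [hs])) hv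
  · intro v hv
    refine latticePairing_nonneg_of_forall (fun s hs => ?_) hv
    have := hm (-s) (Finset.mem_union_right _ (Finset.mem_image_of_mem _ hs))
    simpa using this
  · intro v hv hv0
    rw [latticePairing_neg, LinearMap.neg_apply, neg_eq_zero] at hv0
    -- Here $-v=s-r$, so $v+s=r$ lies in $\sigma\cap\tau$, and the face property puts $v$ there too.
    obtain ⟨s, hs, r, hr, hsr⟩ := hdec _ (hm' v (hS hv) hv0)
    have hvr : v + s = r := by
      rw [neg_eq_iff_eq_neg] at hsr
      rw [hsr]; abel
    have hmem : v + s ∈ latticeCone S ⊓ latticeCone R :=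
      ⟨add_mem hv hs, hvr ▸ hr⟩
    exact (h.mem_of_add_mem_left hv hs hmem).2

end Separation

/-! ## Weights with chain support on finite posets -/

section ChainWeights

open scoped NNReal

universe u v

variable {P : Type v} [PartialOrder P] [Fintype P]

open Classical in
/-- The largest weight of an element which is not above `ρ`. -/
noncomputable def levelOutside (W : P → ℝ≥0) (ρ : P) : ℝ≥0 :=
  Finset.univ.sup fun τ => if ρ ≤ τ then 0 else W τ

open Classical in
/-- The length of the set of all `s` such that `ρ` is the meet of `{τ | s < W τ}`. -/
noncomputable def chainWeight (W : P → ℝ≥0) (ρ : P) : ℝ≥0 :=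
  -- `ρ` is a lower bound of `{τ | s < W τ}` iff `levelOutside W ρ ≤ s`. It is the greatest one as
  -- long as `s < levelOutside W ρ'` for all `ρ' > ρ`; the bound by the supremum of `W` keeps the
  -- set nonempty. Truncated subtraction gives `0` for an empty interval.
  Finset.univ.inf' (Finset.univ_nonempty_iff.2 ⟨ρ⟩)
    (fun ρ' => if ρ < ρ' then levelOutside W ρ' else Finset.univ.sup W) - levelOutside W ρ

theorem continuous_levelOutside (ρ : P) : Continuous fun W : P → ℝ≥0 => levelOutside W ρ := by
  refine Continuous.finset_sup_apply fun τ _ => ?_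
  split_ifs
  · exact continuous_const
  · exact continuous_apply τ

theorem continuous_chainWeight (ρ : P) : Continuous fun W : P → ℝ≥0 => chainWeight W ρ := by
  refine Continuous.sub (Continuous.finset_inf'_apply _ fun ρ' _ => ?_) (continuous_levelOutside ρ)
  split_ifs
  · exact continuous_levelOutside ρ'
  · exact Continuous.finset_sup_apply fun τ _ => continuous_apply τ

theorem le_levelOutside {W : P → ℝ≥0} {ρ τ : P} (h : ¬ρ ≤ τ) : W τ ≤ levelOutside W ρ := by
  classical
  refine le_trans ?_ (Finset.le_sup (Finset.mem_univ τ))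
  rw [if_neg h]

theorem lt_levelOutside_iff {W : P → ℝ≥0} {ρ : P} {a : ℝ≥0} :
    a < levelOutside W ρ ↔ ∃ τ, ¬ρ ≤ τ ∧ a < W τ := by
  classical
  refine ⟨fun h => ?_, fun ⟨τ, h, h'⟩ => h'.trans_le (le_levelOutside h)⟩
  obtain ⟨τ, -, hτ⟩ := Finset.lt_sup_iff.1 h
  by_cases hρ : ρ ≤ τ
  · rw [if_pos hρ] at hτ
    exact absurd hτ not_lt_zero
  · rw [if_neg hρ] at hτ
    exact ⟨τ, hρ, hτ⟩

theorem chainWeight_ne_zero_iff {W : P → ℝ≥0} {ρ : P} :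
    chainWeight W ρ ≠ 0 ↔
      (∃ τ, levelOutside W ρ < W τ) ∧ ∀ ρ', ρ < ρ' → levelOutside W ρ < levelOutside W ρ' := by
  classical
  rw [chainWeight, Ne, tsub_eq_zero_iff_le, not_le, Finset.lt_inf'_iff]
  constructor
  · intro h
    constructor
    · have := h ρ (Finset.mem_univ _)
      rw [if_neg (lt_irrefl ρ)] at this
      obtain ⟨τ, -, hτ⟩ := Finset.lt_sup_iff.1 this
      exact ⟨τ, hτ⟩
    · intro ρ' hρ'
      have := h ρ' (Finset.mem_univ _)
      rwa [if_pos hρ'] at this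
  · rintro ⟨⟨τ, hτ⟩, h⟩ ρ' _
    split_ifs with h'
    · exact h ρ' h'
    · exact Finset.lt_sup_iff.2 ⟨τ, Finset.mem_univ _, hτ⟩

/-- At the left end `s = levelOutside W ρ` of the interval, the meet `κ` is at least `ρ`. If it were
larger, then `levelOutside W κ` would exceed `s`, which gives a member of the set that is not above
`κ`. -/
theorem isGLB_of_chainWeight_ne_zero (hP : ∀ U : Set P, U.Nonempty → ∃ κ, IsGLB U κ)
    {W : P → ℝ≥0} {ρ : P} (h : chainWeight W ρ ≠ 0) :
    {τ | levelOutside W ρ < W τ}.Nonempty ∧ IsGLB {τ | levelOutside W ρ < W τ} ρ := by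
  obtain ⟨⟨τ, hτ⟩, h'⟩ := chainWeight_ne_zero_iff.1 h
  have hne : {τ | levelOutside W ρ < W τ}.Nonempty := ⟨τ, hτ⟩
  refine ⟨hne, ?_⟩
  obtain ⟨κ, hκ⟩ := hP _ hne
  have hρκ : ρ ≤ κ := hκ.2 fun τ (hτ : levelOutside W ρ < W τ) => by
    by_contra hle
    exact absurd hτ (not_lt.2 (le_levelOutside hle))
  rcases hρκ.eq_or_lt with rfl | hlt
  · exact hκ
  · obtain ⟨τ, h1, h2⟩ := lt_levelOutside_iff.1 (h' κ hlt)
    exact absurd (hκ.1 h2) h1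

/-- A higher level has a smaller superlevel set and therefore a larger meet. -/
theorem isChain_support_chainWeight (hP : ∀ U : Set P, U.Nonempty → ∃ κ, IsGLB U κ)
    (W : P → ℝ≥0) : IsChain (· ≤ ·) {ρ | chainWeight W ρ ≠ 0} := by
  have key : ∀ ρ ρ' : P, chainWeight W ρ ≠ 0 → chainWeight W ρ' ≠ 0 →
      levelOutside W ρ ≤ levelOutside W ρ' → ρ ≤ ρ' := by
    intro ρ ρ' h h' hle
    have h1 := (isGLB_of_chainWeight_ne_zero hP h).2
    have h2 := (isGLB_of_chainWeight_ne_zero hP h').2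
    exact h2.2 fun τ (hτ : _ < _) => h1.1 (show _ < _ from hle.trans_lt hτ)
  intro ρ h ρ' h' _
  rcases le_total (levelOutside W ρ) (levelOutside W ρ') with hle | hle
  · exact Or.inl (key ρ ρ' h h' hle)
  · exact Or.inr (key ρ' ρ h' h hle)

/-- The meet of the support of `W` occurs, as the meet at level `0`. -/
theorem exists_chainWeight_ne_zero (hP : ∀ U : Set P, U.Nonempty → ∃ κ, IsGLB U κ)
    {W : P → ℝ≥0} (hW : W ≠ 0) : ∃ ρ, chainWeight W ρ ≠ 0 := by
  obtain ⟨τ, hτ⟩ := Function.ne_iff.1 hW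
  obtain ⟨κ, hκ⟩ := hP {τ | W τ ≠ 0} ⟨τ, hτ⟩
  have h0 : levelOutside W κ = 0 := by
    by_contra h
    obtain ⟨τ, h1, h2⟩ := lt_levelOutside_iff.1 (pos_iff_ne_zero.2 h)
    exact h1 (hκ.1 h2.ne')
  refine ⟨κ, chainWeight_ne_zero_iff.2 ⟨⟨τ, h0 ▸ pos_iff_ne_zero.2 hτ⟩, fun ρ' hρ' => ?_⟩⟩
  rw [h0]
  by_contra h
  refine absurd (hκ.2 fun τ (hτ : W τ ≠ 0) => ?_) hρ'.not_ge
  by_contra hle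
  exact h ((pos_iff_ne_zero.2 hτ).trans_le (le_levelOutside hle))

/-! ### Barycentric coordinates on the order complex. -/

namespace OrderComplexRealization

theorem continuous_val :
    Continuous (Subtype.val : OrderComplexRealization P → P → ℝ) :=
  continuous_subtype_val

theorem continuous_mk {X : Type*} [TopologicalSpace X] {f : X → P → ℝ} (hf : Continuous f)
    (h : ∀ x, f x ∈ stdSimplex ℝ P ∧ IsChain (· ≤ ·) (Function.support (f x))) :
    Continuous fun x => (⟨f x, h x⟩ : OrderComplexRealization P) :=
  hf.subtype_mk h

/-- The barycentric coordinates of a point. -/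
def coord (w : OrderComplexRealization P) (τ : P) : ℝ≥0 := ⟨w.1 τ, w.2.1.1 τ⟩

theorem coord_ne_zero_iff {w : OrderComplexRealization P} {τ : P} :
    w.coord τ ≠ 0 ↔ w.1 τ ≠ 0 := by
  rw [Ne, Ne, ← NNReal.coe_eq_zero]; rfl

theorem continuous_coord : Continuous (coord : OrderComplexRealization P → P → ℝ≥0) :=
  continuous_pi fun τ => ((continuous_apply τ).comp continuous_val).subtype_mk _

theorem coord_ne_zero (w : OrderComplexRealization P) : w.coord ≠ 0 := by
  intro h
  have h1 := w.2.1.2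
  have h2 : ∀ τ, w.1 τ = 0 := fun τ => congrArg NNReal.toReal (congrFun h τ)
  simp [h2] at h1

theorem exists_top (w : OrderComplexRealization P) :
    ∃ τ, w.1 τ ≠ 0 ∧ ∀ ρ, w.1 ρ ≠ 0 → ρ ≤ τ := by
  classical
  obtain ⟨τ₀, hτ₀⟩ := Function.ne_iff.1 w.coord_ne_zero
  obtain ⟨τ, hτ⟩ := (Finset.univ.filter fun τ => w.1 τ ≠ 0).exists_maximal
    ⟨τ₀, by simpa using coord_ne_zero_iff.1 hτ₀⟩
  have hτ1 : w.1 τ ≠ 0 := by simpa using hτ.1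
  refine ⟨τ, hτ1, fun ρ hρ => ?_⟩
  rcases w.2.2.total hρ hτ1 with h | h
  · exact h
  · exact hτ.2 (by simpa using hρ) h

/-- The largest element of the support of a point. -/
noncomputable def top (w : OrderComplexRealization P) : P := w.exists_top.choose

theorem top_ne_zero (w : OrderComplexRealization P) : w.1 w.top ≠ 0 := w.exists_top.choose_spec.1

theorem le_top {w : OrderComplexRealization P} {ρ : P} (h : w.1 ρ ≠ 0) : ρ ≤ w.top :=
  w.exists_top.choose_spec.2 ρ h

/-- The largest barycentric coordinate. -/
noncomputable def peak (w : OrderComplexRealization P) : ℝ≥0 := Finset.univ.sup w.coord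

theorem peak_pos (w : OrderComplexRealization P) : 0 < w.peak :=
  (pos_iff_ne_zero.2 (coord_ne_zero_iff.2 w.top_ne_zero)).trans_le
    (Finset.le_sup (f := w.coord) (Finset.mem_univ _))

theorem continuous_peak : Continuous (peak : OrderComplexRealization P → ℝ≥0) :=
  Continuous.finset_sup_apply fun τ _ => (continuous_apply τ).comp continuous_coord

/-- The barycentric coordinates, rescaled to have maximum `1`. -/
noncomputable def ratio (w : OrderComplexRealization P) (τ : P) : ℝ≥0 := w.coord τ / w.peak

theorem continuous_ratio : Continuous (ratio : OrderComplexRealization P → P → ℝ≥0) :=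
  continuous_pi fun τ => ((continuous_apply τ).comp continuous_coord).div₀ continuous_peak
    fun w => w.peak_pos.ne'

theorem ratio_ne_zero_iff {w : OrderComplexRealization P} {τ : P} :
    w.ratio τ ≠ 0 ↔ w.1 τ ≠ 0 := by
  rw [← coord_ne_zero_iff, ratio, div_ne_zero_iff]
  exact and_iff_left w.peak_pos.ne'

/-- This is the reason for dividing by the peak: some factor `1 - ratio` is exactly zero. -/
theorem exists_ratio_eq_one (w : OrderComplexRealization P) : ∃ τ, w.ratio τ = 1 := by
  obtain ⟨τ, -, hτ⟩ := Finset.exists_mem_eq_sup Finset.univ ⟨w.top, Finset.mem_univ _⟩ w.coord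
  refine ⟨τ, ?_⟩
  rw [ratio, ← hτ]
  exact div_self w.peak_pos.ne'

end OrderComplexRealization

/-- The point of the order complex given by nonzero weights on a poset with meets. -/
noncomputable def toChain (hP : ∀ U : Set P, U.Nonempty → ∃ κ, IsGLB U κ)
    (W : {W : P → ℝ≥0 // W ≠ 0}) : OrderComplexRealization P :=
  ⟨fun ρ => (chainWeight W.1 ρ / ∑ τ, chainWeight W.1 τ : ℝ≥0), by
    have hpos : ∑ τ, chainWeight W.1 τ ≠ 0 := by
      obtain ⟨ρ, hρ⟩ := exists_chainWeight_ne_zero hP W.2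
      exact fun h => hρ (Finset.sum_eq_zero_iff.1 h ρ (Finset.mem_univ ρ))
    refine ⟨⟨fun ρ => NNReal.coe_nonneg _, ?_⟩, ?_⟩
    · rw [← NNReal.coe_sum, ← Finset.sum_div, div_self hpos, NNReal.coe_one]
    · refine (isChain_support_chainWeight hP W.1).mono fun ρ hρ => ?_
      intro h0
      exact hρ (by simp [h0])⟩

theorem chainWeight_ne_zero_of_toChain (hP : ∀ U : Set P, U.Nonempty → ∃ κ, IsGLB U κ)
    {W : {W : P → ℝ≥0 // W ≠ 0}} {ρ : P} (h : (toChain hP W).1 ρ ≠ 0) :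
    chainWeight W.1 ρ ≠ 0 := fun h0 => h (by simp [toChain, h0])

theorem continuous_toChain (hP : ∀ U : Set P, U.Nonempty → ∃ κ, IsGLB U κ) :
    Continuous (toChain hP) := by
  refine OrderComplexRealization.continuous_mk (continuous_pi fun ρ => ?_) _
  refine NNReal.continuous_coe.comp (Continuous.div₀
    ((continuous_chainWeight ρ).comp continuous_subtype_val)
    (continuous_finsetSum _ fun τ _ => (continuous_chainWeight τ).comp continuous_subtype_val)
    fun W h => ?_)
  obtain ⟨ρ, hρ⟩ := exists_chainWeight_ne_zero hP W.2
  exact hρ (Finset.sum_eq_zero_iff.1 h ρ (Finset.mem_univ ρ))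

/-- Vertices that occur in `toChain` are meets of subsets of the support of `W`, so they inherit its
lower bounds. -/
theorem le_of_toChain_ne_zero (hP : ∀ U : Set P, U.Nonempty → ∃ κ, IsGLB U κ)
    {W : {W : P → ℝ≥0 // W ≠ 0}} {p : P} (hp : ∀ τ, W.1 τ ≠ 0 → p ≤ τ) {ρ : P}
    (h : (toChain hP W).1 ρ ≠ 0) : p ≤ ρ :=
  (isGLB_of_chainWeight_ne_zero hP (chainWeight_ne_zero_of_toChain hP h)).2.2
    fun τ (hτ : _ < _) => hp τ (pos_of_gt hτ).ne'

/-- In a chain, the meet of a finite nonempty subset is its minimum. Weights supported on a chain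
are thus sent into the simplex spanned by their own support. -/
theorem ne_zero_of_toChain_ne_zero (hP : ∀ U : Set P, U.Nonempty → ∃ κ, IsGLB U κ)
    {W : {W : P → ℝ≥0 // W ≠ 0}} (hW : IsChain (· ≤ ·) (Function.support W.1)) {ρ : P}
    (h : (toChain hP W).1 ρ ≠ 0) : W.1 ρ ≠ 0 := by
  obtain ⟨hne, hglb⟩ :=
    isGLB_of_chainWeight_ne_zero hP (chainWeight_ne_zero_of_toChain hP h)
  set U := {τ | levelOutside W.1 ρ < W.1 τ}
  have hU : ∀ τ ∈ U, W.1 τ ≠ 0 := fun τ (hτ : _ < _) => (pos_of_gt hτ).ne'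
  obtain ⟨κ, hκ⟩ := U.toFinite.exists_minimal hne
  have hle : κ ≤ ρ := hglb.2 fun τ hτ => by
    rcases hW.total (hU κ hκ.1) (hU τ hτ) with h | h
    · exact h
    · exact hκ.2 hτ h
  have heq : κ = ρ := le_antisymm hle (hglb.1 hκ.1)
  exact heq ▸ hU κ hκ.1

end ChainWeights

/-! ### Maps induced on homotopy colimits. -/

section HomotopyColimitMaps

universe u v

variable {P : Type v} [PartialOrder P] [Fintype P] (D : P ⥤ TopCat.{u})

theorem HomotopyColimit.isQuotientMap_mk :
    Topology.IsQuotientMap (Quot.mk (HomotopyColimit.Rel D) :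
      (Σ p : P, D.obj p × UpperRealization p) → HomotopyColimit D) :=
  isQuotientMap_quot_mk

/-- A self-homotopy of `|𝓕(P)|` which preserves all `|𝓕(P_{≥ p})|` acts on homotopy colimits. -/
def HomotopyColimit.mapUpper {I : Type*} (Ψ : OrderComplexRealization P × I → OrderComplexRealization P)
    (hΨ : ∀ (p : P) (w : OrderComplexRealization P) (s : I),
      (∀ q, w.1 q ≠ 0 → p ≤ q) → ∀ q, (Ψ (w, s)).1 q ≠ 0 → p ≤ q)
    (y : HomotopyColimit D × I) : HomotopyColimit D :=
  Quot.lift (fun z : Σ p : P, D.obj p × UpperRealization p =>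
      (Quot.mk _ ⟨z.1, z.2.1, ⟨Ψ (z.2.2.1, y.2), hΨ z.1 z.2.2.1 y.2 z.2.2.2⟩⟩ : HomotopyColimit D))
    (by
      rintro _ _ ⟨h, x, w⟩
      exact Quot.sound (HomotopyColimit.Rel.glue h x ⟨Ψ (w.1, y.2), hΨ _ w.1 y.2 w.2⟩)) y.1

/-- Since `I` is locally compact, the product of the defining quotient map with `I` is again a
quotient map, so continuity can be checked before gluing. -/
theorem HomotopyColimit.continuous_mapUpper {I : Type*} [TopologicalSpace I] [LocallyCompactSpace I]
    {Ψ : OrderComplexRealization P × I → OrderComplexRealization P} (hc : Continuous Ψ)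
    (hΨ : ∀ (p : P) (w : OrderComplexRealization P) (s : I),
      (∀ q, w.1 q ≠ 0 → p ≤ q) → ∀ q, (Ψ (w, s)).1 q ≠ 0 → p ≤ q) :
    Continuous (HomotopyColimit.mapUpper D Ψ hΨ) := by
  refine (HomotopyColimit.isQuotientMap_mk D).continuous_lift_prod_left ?_
  rw [← (Homeomorph.sigmaProdDistrib).symm.comp_continuous_iff']
  refine continuous_sigma fun p => ?_
  change Continuous fun a : (D.obj p × UpperRealization p) × I =>
    (Quot.mk (HomotopyColimit.Rel D)
      ⟨p, a.1.1, ⟨Ψ (a.1.2.1, a.2), hΨ p a.1.2.1 a.2 a.1.2.2⟩⟩ : HomotopyColimit D)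
  refine (HomotopyColimit.isQuotientMap_mk D).continuous.comp
    (continuous_sigmaMk.comp (Continuous.prodMk (continuous_fst.comp continuous_fst) ?_))
  refine Continuous.subtype_mk (hc.comp (Continuous.prodMk ?_ continuous_snd)) _
  exact continuous_subtype_val.comp (continuous_snd.comp continuous_fst)

end HomotopyColimitMaps

/-! ## Points of affine toric varieties and their orbits -/

section AffinePoints

universe u

variable {N : Type u} [AddCommGroup N]

/-- The properties of the monoids `ℂ`, `ℝ` and `[0,∞)` which make the toric varieties over them
homotopy colimits. -/
structure Submonoid.IsToricScalar (k : Submonoid ℂ) : Prop where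
  zero_mem : (0 : ℂ) ∈ k
  ofReal_mem : ∀ r : ℝ, 0 ≤ r → (r : ℂ) ∈ k
  inv_mem : ∀ z ∈ k, z⁻¹ ∈ k
  isClosed : IsClosed (k : Set ℂ)

theorem Submonoid.isToricScalar_of_eq {k : Submonoid ℂ}
    (hk : k = ⊤ ∨ (k : Set ℂ) = Set.range ((↑) : ℝ → ℂ) ∨
      (k : Set ℂ) = ((↑) : ℝ → ℂ) '' Set.Ici 0) : k.IsToricScalar := by
  rcases hk with rfl | hk | hk
  · exact ⟨trivial, fun _ _ => trivial, fun _ _ => trivial, isClosed_univ⟩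
  · have hmem : ∀ z, z ∈ k ↔ z ∈ Set.range ((↑) : ℝ → ℂ) := fun z => by rw [← hk]; rfl
    refine ⟨(hmem _).2 ⟨0, rfl⟩, fun r _ => (hmem _).2 ⟨r, rfl⟩, fun z hz => ?_, ?_⟩
    · obtain ⟨r, rfl⟩ := (hmem _).1 hz
      exact (hmem _).2 ⟨r⁻¹, Complex.ofReal_inv r⟩
    · rw [hk]
      exact Complex.isometry_ofReal.isClosedEmbedding.isClosed_range
  · have hmem : ∀ z, z ∈ k ↔ z ∈ ((↑) : ℝ → ℂ) '' Set.Ici 0 := fun z => by rw [← hk]; rfl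
    refine ⟨(hmem _).2 ⟨0, Set.self_mem_Ici, rfl⟩, fun r hr => (hmem _).2 ⟨r, hr, rfl⟩,
      fun z hz => ?_, ?_⟩
    · obtain ⟨r, hr, rfl⟩ := (hmem _).1 hz
      exact (hmem _).2 ⟨r⁻¹, inv_nonneg.2 (show (0 : ℝ) ≤ r from hr), Complex.ofReal_inv r⟩
    · rw [hk]
      exact Complex.isometry_ofReal.isClosedEmbedding.isClosedMap _ isClosed_Ici

/-- On a generator `s` either `g s = 0`, where `m s ≥ 0` by hypothesis, or `g s ≥ 1` by integrality,
where a multiple exceeding `|m s|` suffices. The sum of all `|m s|` works for all generators at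
once. -/
theorem exists_nsmul_add_mem_dualMonoid {σ : PointedCone ℝ (ℝ ⊗[ℤ] N)} (hσ : IsRationalCone σ)
    {g m : Module.Dual ℤ N} (hg : g ∈ dualMonoid σ)
    (h : ∀ v ∈ σ, latticePairing g v = 0 → 0 ≤ latticePairing m v) :
    ∃ n : ℕ, m + n • g ∈ dualMonoid σ := by
  obtain ⟨S, rfl⟩ := hσ
  change g ∈ dualMonoid (latticeCone S) at hg
  change ∀ v ∈ latticeCone S, _ at h
  refine ⟨∑ s ∈ S, (m s).natAbs, fun v hv => latticePairing_nonneg_of_forall (fun s hs => ?_) hv⟩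
  have hgs := hg _ (one_tmul_mem_latticeCone hs)
  rw [latticePairing_one_tmul] at hgs
  have hgs' : 0 ≤ g s := by exact_mod_cast hgs
  rw [LinearMap.add_apply, LinearMap.smul_apply, nsmul_eq_mul]
  have hle : (m s).natAbs ≤ ∑ s ∈ S, (m s).natAbs :=
    Finset.single_le_sum (f := fun s => (m s).natAbs) (fun _ _ => Nat.zero_le _) hs
  rcases hgs'.eq_or_lt with h0 | hpos
  · have := h _ (one_tmul_mem_latticeCone hs) (by rw [latticePairing_one_tmul, ← h0]; simp)
    rw [latticePairing_one_tmul] at this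
    rw [← h0, mul_zero, add_zero]
    exact_mod_cast this
  · have h1 : ((m s).natAbs : ℤ) ≤ (∑ s ∈ S, (m s).natAbs : ℕ) := by exact_mod_cast hle
    have h2 : -(m s) ≤ ((m s).natAbs : ℤ) := by omega
    have h3 : ((∑ s ∈ S, (m s).natAbs : ℕ) : ℤ) * 1 ≤ ((∑ s ∈ S, (m s).natAbs : ℕ) : ℤ) * g s :=
      mul_le_mul_of_nonneg_left (by omega) (by positivity)
    linarith

namespace AffineToric

variable {k : Submonoid ℂ} {σ τ : PointedCone ℝ (ℝ ⊗[ℤ] N)}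

theorem val_zero (x : AffineToric k σ) : x.val 0 = 1 :=
  congrArg Subtype.val x.toHom.map_one

theorem val_add (x : AffineToric k σ) (a b : dualMonoid σ) : x.val (a + b) = x.val a * x.val b :=
  congrArg Subtype.val (x.toHom.map_mul (Multiplicative.ofAdd a) (Multiplicative.ofAdd b))

theorem val_mem (x : AffineToric k σ) (a : dualMonoid σ) : x.val a ∈ k :=
  (x.toHom (Multiplicative.ofAdd a)).2

theorem ext_val {x y : AffineToric k σ} (h : ∀ a, x.val a = y.val a) : x = y :=
  MonoidHom.ext fun a => Subtype.ext (h a.toAdd)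

/-- The point of `X_σ(k)` with given values. -/
def ofVal (f : dualMonoid σ → ℂ) (hk : ∀ a, f a ∈ k) (h0 : f 0 = 1)
    (hadd : ∀ a b, f (a + b) = f a * f b) : AffineToric k σ :=
  show Multiplicative (dualMonoid σ) →* k from
  { toFun := fun a => ⟨f a.toAdd, hk _⟩
    map_one' := Subtype.ext h0
    map_mul' := fun a b => Subtype.ext (hadd a.toAdd b.toAdd) }

theorem val_ofVal (f : dualMonoid σ → ℂ) (hk : ∀ a, f a ∈ k) (h0 : f 0 = 1)
    (hadd : ∀ a b, f (a + b) = f a * f b) (a : dualMonoid σ) : (ofVal f hk h0 hadd).val a = f a :=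
  rfl

theorem val_nsmul (x : AffineToric k σ) (n : ℕ) (a : dualMonoid σ) :
    x.val (n • a) = x.val a ^ n := by
  induction n with
  | zero => rw [zero_smul, val_zero, pow_zero]
  | succ n ih => rw [succ_nsmul, val_add, ih, pow_succ]

theorem val_sum {ι : Type*} (x : AffineToric k σ) (s : Finset ι) (f : ι → dualMonoid σ) :
    x.val (∑ i ∈ s, f i) = ∏ i ∈ s, x.val (f i) := by
  classical
  induction s using Finset.induction_on with
  | empty => simp [val_zero]
  | insert a s ha ih => rw [Finset.sum_insert ha, Finset.prod_insert ha, val_add, ih]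

theorem val_restrict (h : τ ≤ σ) (x : AffineToric k τ) (a : dualMonoid σ) :
    (restrict h x).val a = x.val ⟨a, dualMonoid_anti h a.2⟩ :=
  rfl

theorem val_smul (t : CompactTorus N k) (x : AffineToric k σ) (a : dualMonoid σ) :
    (t • x).val a = (t.val (a : Module.Dual ℤ N) : ℂ) * x.val a :=
  rfl

theorem isInducing_val : Topology.IsInducing (val : AffineToric k σ → dualMonoid σ → ℂ) :=
  ⟨rfl⟩

theorem continuous_val (a : dualMonoid σ) : Continuous fun x : AffineToric k σ => x.val a :=
  (continuous_apply a).comp isInducing_val.continuous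

theorem continuous_iff_val {Z : Type*} [TopologicalSpace Z] {f : Z → AffineToric k σ} :
    Continuous f ↔ ∀ a, Continuous fun z => (f z).val a := by
  rw [isInducing_val.continuous_iff, continuous_pi_iff]
  rfl

/-- The smallest face of `σ` such that a point of `X_σ(k)` comes from the toric variety of
this face. -/
def face (x : AffineToric k σ) : PointedCone ℝ (ℝ ⊗[ℤ] N) where
  carrier := {v | v ∈ σ ∧ ∀ a : dualMonoid σ, x.val a ≠ 0 → latticePairing a.1 v = 0}
  zero_mem' := ⟨zero_mem _, fun _ _ => map_zero _⟩
  add_mem' := fun {v w} hv hw => ⟨add_mem hv.1 hw.1, fun a ha => by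
    rw [map_add, hv.2 a ha, hw.2 a ha, add_zero]⟩
  smul_mem' := fun c v hv => ⟨Submodule.smul_mem _ c hv.1, fun a ha => by
    change latticePairing a.1 ((c : ℝ) • v) = 0
    rw [map_smul, hv.2 a ha, smul_zero]⟩

theorem mem_face {x : AffineToric k σ} {v : ℝ ⊗[ℤ] N} :
    v ∈ x.face ↔ v ∈ σ ∧ ∀ a : dualMonoid σ, x.val a ≠ 0 → latticePairing a.1 v = 0 :=
  Iff.rfl

theorem face_le (x : AffineToric k σ) : x.face ≤ σ := fun _ hv => hv.1

theorem isFaceOf_face (x : AffineToric k σ) : x.face.IsFaceOf σ where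
  le := x.face_le
  mem_of_smul_add_mem := fun {v w c} hv hw hc h => ⟨hv, fun a ha => by
    have h1 := h.2 a ha
    rw [map_add, map_smul, smul_eq_mul] at h1
    have h2 := a.2 v hv
    have h3 := a.2 w hw
    have h4 := mul_nonneg hc.le h2
    have h5 : c * latticePairing a.1 v = 0 := by linarith
    exact (mul_eq_zero.1 h5).resolve_left hc.ne'⟩

/-- One monomial that does not vanish at `x` cuts out `x.face`: add up, over the generators outside
the face, monomials which witness that they are outside. The value at the sum is a product of
nonzero values. -/
theorem exists_generic (hσ : IsRationalCone σ) (x : AffineToric k σ) :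
    ∃ a : dualMonoid σ, x.val a ≠ 0 ∧ ∀ v ∈ σ, latticePairing a.1 v = 0 → v ∈ x.face := by
  classical
  obtain ⟨S, hS⟩ := hσ
  change σ = latticeCone S at hS
  have hSσ : ∀ s ∈ S, (1 : ℝ) ⊗ₜ[ℤ] s ∈ σ := fun s hs => hS ▸ one_tmul_mem_latticeCone hs
  have h : ∀ s : N, ∃ a : dualMonoid σ, x.val a ≠ 0 ∧
      ((1 : ℝ) ⊗ₜ[ℤ] s ∈ σ → (1 : ℝ) ⊗ₜ[ℤ] s ∉ x.face →
        latticePairing a.1 ((1 : ℝ) ⊗ₜ[ℤ] s) ≠ 0) := by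
    intro s
    by_cases hs : (1 : ℝ) ⊗ₜ[ℤ] s ∈ x.face
    · exact ⟨0, by rw [val_zero]; exact one_ne_zero, fun _ h => absurd hs h⟩
    · by_cases hs' : (1 : ℝ) ⊗ₜ[ℤ] s ∈ σ
      · rw [mem_face] at hs
        push Not at hs
        obtain ⟨a, ha, ha'⟩ := hs hs'
        exact ⟨a, ha, fun _ _ => ha'⟩
      · exact ⟨0, by rw [val_zero]; exact one_ne_zero, fun h => absurd h hs'⟩
  choose f hf hf' using h
  refine ⟨∑ s ∈ S, f s, ?_, ?_⟩
  · rw [val_sum]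
    exact Finset.prod_ne_zero_iff.2 fun s _ => hf s
  · intro v hv h0
    rw [hS] at hv
    obtain ⟨c, hc, rfl⟩ := mem_latticeCone_iff.1 hv
    have hnn : ∀ r ∈ S, ∀ s ∈ S, 0 ≤ latticePairing (f s).1 ((1 : ℝ) ⊗ₜ[ℤ] r) :=
      fun r hr s _ => (f s).2 _ (hSσ r hr)
    rw [AddSubmonoid.coe_finsetSum, latticePairing_sum, LinearMap.sum_apply] at h0
    simp only [map_sum, map_smul, smul_eq_mul] at h0
    refine Submodule.sum_mem _ fun r hr => ?_
    by_cases hrf : (1 : ℝ) ⊗ₜ[ℤ] r ∈ x.face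
    · exact Submodule.smul_mem _ (⟨c r, hc r⟩ : {r : ℝ // 0 ≤ r}) hrf
    · have h1 := (Finset.sum_eq_zero_iff_of_nonneg fun s hs =>
        Finset.sum_nonneg fun r hr => mul_nonneg (hc r) (hnn r hr s hs)).1 h0 r hr
      have h2 := (Finset.sum_eq_zero_iff_of_nonneg fun r' hr' =>
        mul_nonneg (hc r') (hnn r' hr' r hr)).1 h1 r hr
      have h3 : c r = 0 := (mul_eq_zero.1 h2).resolve_right (hf' r (hSσ r hr) hrf)
      rw [h3, zero_smul]
      exact zero_mem _

/-- The elements of `M` at which a point of `X_σ(k)` can be evaluated. -/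
theorem mem_dualMonoid_face_iff (hσ : IsRationalCone σ) (x : AffineToric k σ)
    {m : Module.Dual ℤ N} :
    m ∈ dualMonoid x.face ↔ ∃ a : dualMonoid σ, x.val a ≠ 0 ∧ m + a.1 ∈ dualMonoid σ := by
  constructor
  · intro hm
    obtain ⟨g, hg, hg'⟩ := x.exists_generic hσ
    obtain ⟨n, hn⟩ := exists_nsmul_add_mem_dualMonoid hσ g.2 fun v hv h0 => hm v (hg' v hv h0)
    exact ⟨n • g, by rw [val_nsmul]; exact pow_ne_zero n hg, hn⟩
  · rintro ⟨a, ha, h⟩ v hv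
    have h1 := h v hv.1
    rwa [latticePairing_add, LinearMap.add_apply, hv.2 a ha, add_zero] at h1

open Classical in
/-- The value of a point of `X_σ(k)` at `m ∈ M`, if `m` is a quotient of elements of `σ^∨ ∩ M`
with nonvanishing denominator, and `0` otherwise. -/
noncomputable def gval (x : AffineToric k σ) (m : Module.Dual ℤ N) : ℂ :=
  if h : ∃ a : dualMonoid σ, x.val a ≠ 0 ∧ m + a.1 ∈ dualMonoid σ then
    x.val ⟨m + h.choose.1, h.choose_spec.2⟩ / x.val h.choose else 0

theorem gval_eq (x : AffineToric k σ) {m : Module.Dual ℤ N} {a : dualMonoid σ}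
    (ha : x.val a ≠ 0) (h : m + a.1 ∈ dualMonoid σ) : x.gval m = x.val ⟨m + a.1, h⟩ / x.val a := by
  have hex : ∃ a : dualMonoid σ, x.val a ≠ 0 ∧ m + a.1 ∈ dualMonoid σ := ⟨a, ha, h⟩
  rw [gval, dif_pos hex, div_eq_div_iff hex.choose_spec.1 ha, ← val_add, ← val_add]
  exact congrArg x.val (Subtype.ext (add_right_comm m _ _))

theorem gval_of_mem (x : AffineToric k σ) {m : Module.Dual ℤ N} (hm : m ∈ dualMonoid σ) :
    x.gval m = x.val ⟨m, hm⟩ := by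
  have h0 : x.val 0 ≠ 0 := by rw [val_zero]; exact one_ne_zero
  have h : m + (0 : dualMonoid σ).1 ∈ dualMonoid σ := by simpa using hm
  rw [x.gval_eq h0 h, val_zero, div_one]
  exact congrArg x.val (Subtype.ext (add_zero m))

theorem gval_zero (x : AffineToric k σ) : x.gval 0 = 1 :=
  (x.gval_of_mem (zero_mem _)).trans x.val_zero

theorem gval_add (hσ : IsRationalCone σ) (x : AffineToric k σ) {m n : Module.Dual ℤ N}
    (hm : m ∈ dualMonoid x.face) (hn : n ∈ dualMonoid x.face) :
    x.gval (m + n) = x.gval m * x.gval n := by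
  obtain ⟨a, ha, ha'⟩ := (x.mem_dualMonoid_face_iff hσ).1 hm
  obtain ⟨b, hb, hb'⟩ := (x.mem_dualMonoid_face_iff hσ).1 hn
  have hab : x.val (a + b) ≠ 0 := by rw [val_add]; exact mul_ne_zero ha hb
  have heq : m + n + (a + b : dualMonoid σ).1 = (m + a.1) + (n + b.1) := by
    rw [AddSubmonoid.coe_add]; abel
  rw [x.gval_eq ha ha', x.gval_eq hb hb', x.gval_eq hab (heq ▸ add_mem ha' hb'), div_mul_div_comm,
    ← val_add, ← val_add]
  exact congrArg (fun c => x.val c / x.val (a + b)) (Subtype.ext heq)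

theorem gval_mem (hk : k.IsToricScalar) (x : AffineToric k σ) (m : Module.Dual ℤ N) :
    x.gval m ∈ k := by
  rw [gval]
  split_ifs
  · rw [div_eq_mul_inv]
    exact mul_mem (x.val_mem _) (hk.inv_mem _ (x.val_mem _))
  · exact hk.zero_mem

/-- For `m` orthogonal to the face, `-m` can be evaluated too and the two values multiply to `1`.
Conversely, a nonzero value has a numerator that is a nonvanishing monomial, orthogonal to the face
by definition. -/
theorem gval_ne_zero_iff (hσ : IsRationalCone σ) (x : AffineToric k σ) {m : Module.Dual ℤ N}
    (hm : m ∈ dualMonoid x.face) : x.gval m ≠ 0 ↔ m ∈ perpGroup x.face := by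
  constructor
  · intro h v hv
    obtain ⟨a, ha, ha'⟩ := (x.mem_dualMonoid_face_iff hσ).1 hm
    rw [x.gval_eq ha ha'] at h
    have h1 := hv.2 _ (left_ne_zero_of_mul h)
    rwa [latticePairing_add, LinearMap.add_apply, hv.2 a ha, add_zero] at h1
  · intro h
    have hneg : -m ∈ dualMonoid x.face := fun v hv => (neg_mem h v hv).ge
    have h1 := x.gval_add hσ hm hneg
    rw [add_neg_cancel, gval_zero] at h1
    exact left_ne_zero_of_mul (h1 ▸ one_ne_zero)

theorem mem_perpGroup_face_iff (hσ : IsRationalCone σ) (x : AffineToric k σ) (a : dualMonoid σ) :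
    x.val a ≠ 0 ↔ a.1 ∈ perpGroup x.face := by
  rw [← x.gval_ne_zero_iff hσ (dualMonoid_anti x.face_le a.2), x.gval_of_mem a.2]

/-! ### Restriction to a face cut out by a functional. -/

section Restrict

variable {e : Module.Dual ℤ N}

theorem exists_add_mem_of_exposed (hσ : IsRationalCone σ) (he : e ∈ dualMonoid σ)
    (heτ' : ∀ v ∈ σ, latticePairing e v = 0 → v ∈ τ)
    {m : Module.Dual ℤ N} (hm : m ∈ dualMonoid τ) : ∃ n : ℕ, m + n • e ∈ dualMonoid σ :=
  exists_nsmul_add_mem_dualMonoid hσ he fun v hv h0 => hm v (heτ' v hv h0)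

theorem val_ne_zero_of_neg_mem (x : AffineToric k τ) {a : dualMonoid τ}
    (ha : -a.1 ∈ dualMonoid τ) : x.val a ≠ 0 := by
  have h := x.val_add a ⟨_, ha⟩
  have h0 : a + ⟨_, ha⟩ = 0 := Subtype.ext (add_neg_cancel a.1)
  rw [h0, val_zero] at h
  exact left_ne_zero_of_mul (h ▸ one_ne_zero)

variable (hσ : IsRationalCone σ) (h : τ ≤ σ) (he : e ∈ dualMonoid σ) (heτ : -e ∈ dualMonoid τ)
  (heτ' : ∀ v ∈ σ, latticePairing e v = 0 → v ∈ τ) (x : AffineToric k τ)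

include hσ he heτ heτ'

/-- The functional `e` is invertible on `τ`, and adding multiples of it moves all of $\tau^\vee\cap
M$ into $\sigma^\vee\cap M$. So the nonvanishing monomials of `x` and of its restriction cut out the
same vectors. -/
theorem face_restrict : (restrict h x).face = x.face := by
  have hex : ∀ n : ℕ, x.val (n • (⟨e, dualMonoid_anti h he⟩ : dualMonoid τ)) ≠ 0 := fun n => by
    rw [val_nsmul]
    exact pow_ne_zero n (x.val_ne_zero_of_neg_mem heτ)
  ext v
  constructor
  · intro hv
    have he0 : latticePairing e v = 0 := hv.2 ⟨e, he⟩ (by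
      rw [val_restrict]; exact x.val_ne_zero_of_neg_mem heτ)
    refine ⟨heτ' v hv.1 he0, fun a ha => ?_⟩
    obtain ⟨n, hn⟩ := exists_add_mem_of_exposed hσ he heτ' a.2
    have h1 := hv.2 ⟨_, hn⟩ (by
      rw [val_restrict]
      have := x.val_add a (n • ⟨e, dualMonoid_anti h he⟩)
      exact this ▸ mul_ne_zero ha (hex n))
    rwa [latticePairing_add, LinearMap.add_apply, latticePairing_nsmul, LinearMap.smul_apply, he0,
      smul_zero, add_zero] at h1
  · intro hv
    exact ⟨h hv.1, fun a ha => hv.2 ⟨a, dualMonoid_anti h a.2⟩ ha⟩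

/-- Enlarging a denominator by multiples of `e`, whose value is nonzero, turns a fraction over `τ`
into one over `σ` with the same value. -/
theorem gval_restrict : (restrict h x).gval = x.gval := by
  have hex : ∀ n : ℕ, x.val (n • (⟨e, dualMonoid_anti h he⟩ : dualMonoid τ)) ≠ 0 := fun n => by
    rw [val_nsmul]
    exact pow_ne_zero n (x.val_ne_zero_of_neg_mem heτ)
  funext m
  by_cases hm : ∃ a : dualMonoid τ, x.val a ≠ 0 ∧ m + a.1 ∈ dualMonoid τ
  · obtain ⟨a, ha, ha'⟩ := hm
    obtain ⟨n, hn⟩ := exists_add_mem_of_exposed hσ he heτ' ha'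
    obtain ⟨n', hn'⟩ := exists_add_mem_of_exposed hσ he heτ' a.2
    let b : dualMonoid σ := ⟨a.1 + (n + n') • e, by
      rw [add_comm n, add_smul, ← add_assoc]; exact add_mem hn' (nsmul_mem he n)⟩
    have hb : m + b.1 ∈ dualMonoid σ := by
      have : m + b.1 = m + a.1 + n • e + n' • e := by simp only [b, add_smul]; abel
      rw [this]; exact add_mem hn (nsmul_mem he n')
    have hb0 : x.val ⟨b.1, dualMonoid_anti h b.2⟩ ≠ 0 := by
      have := x.val_add a ((n + n') • ⟨e, dualMonoid_anti h he⟩)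
      exact this ▸ mul_ne_zero ha (hex _)
    rw [gval_eq (restrict h x) (a := b) hb0 hb, x.gval_eq hb0 (dualMonoid_anti h hb)]
    rfl
  · have hm' : ¬∃ a : dualMonoid σ, (restrict h x).val a ≠ 0 ∧ m + a.1 ∈ dualMonoid σ :=
      fun ⟨a, ha, ha'⟩ => hm ⟨⟨a, dualMonoid_anti h a.2⟩, ha, dualMonoid_anti h ha'⟩
    rw [gval, gval, dif_neg hm, dif_neg hm']

end Restrict

/-- Near `x` the generic monomial of `x` stays nonzero, and wherever it is nonzero the face is
contained in its zero set in `σ`. -/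
theorem eventually_face_le (hσ : IsRationalCone σ) (x : AffineToric k σ) :
    ∀ᶠ y in nhds x, y.face ≤ x.face := by
  obtain ⟨g, hg, hg'⟩ := x.exists_generic hσ
  filter_upwards [(continuous_val g).continuousAt.eventually_ne hg] with y hy v hv
  exact hg' v hv.1 (hv.2 g hy)

theorem continuousAt_gval (hσ : IsRationalCone σ) (x : AffineToric k σ) {m : Module.Dual ℤ N}
    (hm : m ∈ dualMonoid x.face) : ContinuousAt (fun y : AffineToric k σ => y.gval m) x := by
  obtain ⟨a, ha, ha'⟩ := (x.mem_dualMonoid_face_iff hσ).1 hm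
  have h : ContinuousAt (fun y : AffineToric k σ => y.val ⟨m + a.1, ha'⟩ / y.val a) x :=
    (continuous_val _).continuousAt.div (continuous_val a).continuousAt ha
  refine h.congr ?_
  filter_upwards [(continuous_val a).continuousAt.eventually_ne ha] with y hy
  exact (y.gval_eq hy ha').symm

theorem face_eq_of_norm_eq {x y : AffineToric k σ} (h : ∀ a, ‖x.val a‖ = ‖y.val a‖) :
    x.face = y.face := by
  have h' : ∀ a, x.val a ≠ 0 ↔ y.val a ≠ 0 := fun a => by
    rw [← norm_ne_zero_iff, h, norm_ne_zero_iff]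
  ext v
  rw [mem_face, mem_face]
  simp only [h']

theorem norm_gval_eq_of_norm_eq {x y : AffineToric k σ} (h : ∀ a, ‖x.val a‖ = ‖y.val a‖)
    (m : Module.Dual ℤ N) : ‖x.gval m‖ = ‖y.gval m‖ := by
  have h' : ∀ a, x.val a ≠ 0 ↔ y.val a ≠ 0 := fun a => by
    rw [← norm_ne_zero_iff, h, norm_ne_zero_iff]
  by_cases hm : ∃ a : dualMonoid σ, x.val a ≠ 0 ∧ m + a.1 ∈ dualMonoid σ
  · obtain ⟨a, ha, ha'⟩ := hm
    rw [x.gval_eq ha ha', y.gval_eq ((h' a).1 ha) ha', norm_div, norm_div, h, h]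
  · have hm' : ¬∃ a : dualMonoid σ, y.val a ≠ 0 ∧ m + a.1 ∈ dualMonoid σ := by
      simpa only [h'] using hm
    rw [gval, gval, dif_neg hm, dif_neg hm']

end AffineToric

end AffinePoints

/-! ## Points of toric varieties -/

section ToricPoints

universe u

namespace RationalFan

variable {N : Type u} [AddCommGroup N] (F : RationalFan N) {k : Submonoid ℂ}

/-- The point of `X_Σ(k)` given by a point of an affine piece. -/
def point (σ : F.Cone) (x : AffineToric k σ.1) : F.ToricVariety k := Quot.mk _ ⟨σ, x⟩

theorem isQuotientMap_point :
    Topology.IsQuotientMap fun z : Σ σ : F.Cone, AffineToric k σ.1 => F.point z.1 z.2 :=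
  isQuotientMap_quot_mk

theorem continuous_point (σ : F.Cone) :
    Continuous (F.point σ : AffineToric k σ.1 → F.ToricVariety k) :=
  F.isQuotientMap_point.continuous.comp continuous_sigmaMk

theorem continuous_iff_point {Z : Type*} [TopologicalSpace Z] {f : F.ToricVariety k → Z} :
    Continuous f ↔ ∀ σ, Continuous fun x : AffineToric k σ.1 => f (F.point σ x) := by
  rw [F.isQuotientMap_point.continuous_iff, continuous_sigma_iff]
  rfl

theorem isOpen_iff_point {U : Set (F.ToricVariety k)} :
    IsOpen U ↔ ∀ σ, IsOpen (F.point σ ⁻¹' U) := by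
  rw [← F.isQuotientMap_point.isOpen_preimage, isOpen_sigma_iff]
  rfl

theorem exists_point (x : F.ToricVariety k) : ∃ (σ : F.Cone) (y : AffineToric k σ.1),
    x = F.point σ y := by
  obtain ⟨⟨σ, y⟩, rfl⟩ := Quot.exists_rep x
  exact ⟨σ, y, rfl⟩

theorem point_restrict {τ σ : F.Cone} (h : τ ≤ σ) (x : AffineToric k τ.1) :
    F.point σ (AffineToric.restrict h x) = F.point τ x :=
  (Quot.sound (Glue.glue h x)).symm

/-- Meets are intersections, which stay in the fan because they are faces of its cones. This is the
hypothesis that `toChain` needs. -/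
theorem exists_isGLB (U : Set F.Cone) (hU : U.Nonempty) : ∃ κ : F.Cone, IsGLB U κ := by
  classical
  have h : ∀ s : Finset F.Cone, s.Nonempty → ∃ κ : F.Cone, IsGLB (s : Set F.Cone) κ := by
    intro s hs
    induction hs using Finset.Nonempty.cons_induction with
    | singleton a => exact ⟨a, by simp⟩
    | cons a s ha hs ih =>
      obtain ⟨κ, hκ⟩ := ih
      refine ⟨⟨a.1 ⊓ κ.1, F.face_mem _ a.2 _ (F.inter_face _ a.2 _ κ.2).1⟩, ?_, ?_⟩
      · intro b hb
        rcases Finset.mem_cons.1 (Finset.mem_coe.1 hb) with rfl | hb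
        · exact (inf_le_left : b.1 ⊓ κ.1 ≤ b.1)
        · exact (inf_le_right : a.1 ⊓ κ.1 ≤ κ.1).trans (hκ.1 hb)
      · intro c hc
        have h1 : c ≤ a := hc (by simp)
        have h2 : c ≤ κ := hκ.2 fun b hb => hc (by simp [Finset.mem_coe.1 hb])
        exact (le_inf h1 h2 : c.1 ≤ a.1 ⊓ κ.1)
  have := h U.toFinite.toFinset (by simpa using hU)
  simpa using this

/-- Strong convexity makes the zero cone a face. It is the common index over which all points of the
homotopy colimit can be represented. -/
theorem exists_bot (σ : F.Cone) : ∃ β : F.Cone, ∀ τ : F.Cone, β ≤ τ := by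
  refine ⟨⟨⊥, F.face_mem _ σ.2 _ ⟨bot_le, fun {x y c} hx hy hc h => ?_⟩⟩,
    fun τ => (bot_le : (⊥ : PointedCone ℝ (ℝ ⊗[ℤ] N)) ≤ τ.1)⟩
  rw [Submodule.mem_bot] at h ⊢
  by_contra hx0
  have hneg : -(c • x) = y := neg_eq_of_add_eq_zero_right h
  refine F.salient _ σ.2 (c • x) (Submodule.smul_mem _ (⟨c, hc.le⟩ : {r : ℝ // 0 ≤ r}) hx)
    (smul_ne_zero hc.ne' hx0) ?_
  rw [hneg]
  exact hy

variable [Module.Free ℤ N] [Module.Finite ℤ N]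

theorem exists_separating (σ τ : F.Cone) :
    ∃ m : Module.Dual ℤ N, -m ∈ dualMonoid σ.1 ∧ m ∈ dualMonoid τ.1 ∧
      ∀ v ∈ σ.1, latticePairing m v = 0 → v ∈ τ.1 :=
  _root_.exists_separating (F.rational _ σ.2) (F.rational _ τ.2) (F.inter_face _ σ.2 _ τ.2).1

theorem face_restrict {τ σ : F.Cone} (h : τ ≤ σ) (x : AffineToric k τ.1) :
    (AffineToric.restrict h x).face = x.face := by
  obtain ⟨m, h1, h2, h3⟩ := F.exists_separating σ τ
  refine AffineToric.face_restrict (F.rational _ σ.2) h h1 (by rwa [neg_neg]) (fun v hv h0 => ?_) x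
  exact h3 v hv (by simpa [latticePairing_neg] using h0)

theorem gval_restrict {τ σ : F.Cone} (h : τ ≤ σ) (x : AffineToric k τ.1) :
    (AffineToric.restrict h x).gval = x.gval := by
  obtain ⟨m, h1, h2, h3⟩ := F.exists_separating σ τ
  refine AffineToric.gval_restrict (F.rational _ σ.2) h h1 (by rwa [neg_neg]) (fun v hv h0 => ?_) x
  exact h3 v hv (by simpa [latticePairing_neg] using h0)

/-- The cone of the orbit of a point of `X_Σ(k)`. -/
def orbitCone (x : F.ToricVariety k) : F.Cone :=
  Quot.lift (fun z : Σ σ : F.Cone, AffineToric k σ.1 =>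
      (⟨z.2.face, F.face_mem _ z.1.2 _ z.2.isFaceOf_face⟩ : F.Cone))
    (by rintro _ _ ⟨h, x⟩; exact Subtype.ext (F.face_restrict h x).symm) x

/-- The values of a point of `X_Σ(k)`, seen as a monoid homomorphism. -/
noncomputable def eval (x : F.ToricVariety k) : Module.Dual ℤ N → ℂ :=
  Quot.lift (fun z : Σ σ : F.Cone, AffineToric k σ.1 => z.2.gval)
    (by rintro _ _ ⟨h, x⟩; exact (F.gval_restrict h x).symm) x

theorem orbitCone_point_le (σ : F.Cone) (x : AffineToric k σ.1) :
    F.orbitCone (F.point σ x) ≤ σ := x.face_le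

theorem eval_point (σ : F.Cone) (x : AffineToric k σ.1) : F.eval (F.point σ x) = x.gval := rfl

theorem eval_point_of_mem (σ : F.Cone) (x : AffineToric k σ.1) (a : dualMonoid σ.1) :
    F.eval (F.point σ x) a = x.val a := x.gval_of_mem a.2

theorem eval_zero (x : F.ToricVariety k) : F.eval x 0 = 1 := by
  obtain ⟨σ, y, rfl⟩ := F.exists_point x
  exact y.gval_zero

theorem eval_mem (hk : k.IsToricScalar) (x : F.ToricVariety k) (m : Module.Dual ℤ N) :
    F.eval x m ∈ k := by
  obtain ⟨σ, y, rfl⟩ := F.exists_point x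
  exact y.gval_mem hk m

theorem eval_add (x : F.ToricVariety k) {m n : Module.Dual ℤ N}
    (hm : m ∈ dualMonoid (F.orbitCone x).1) (hn : n ∈ dualMonoid (F.orbitCone x).1) :
    F.eval x (m + n) = F.eval x m * F.eval x n := by
  obtain ⟨σ, y, rfl⟩ := F.exists_point x
  exact y.gval_add (F.rational _ σ.2) hm hn

theorem eval_ne_zero_iff (x : F.ToricVariety k) {m : Module.Dual ℤ N}
    (hm : m ∈ dualMonoid (F.orbitCone x).1) :
    F.eval x m ≠ 0 ↔ m ∈ perpGroup (F.orbitCone x).1 := by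
  obtain ⟨σ, y, rfl⟩ := F.exists_point x
  exact y.gval_ne_zero_iff (F.rational _ σ.2) hm

/-- A point of `X_Σ(k)`, as a point of `X_τ(k)`. -/
noncomputable def germ (hk : k.IsToricScalar) (x : F.ToricVariety k) (τ : F.Cone)
    (h : F.orbitCone x ≤ τ) : AffineToric k τ.1 :=
  AffineToric.ofVal (fun a => F.eval x a) (fun a => F.eval_mem hk x a) (F.eval_zero x)
    fun a b => F.eval_add x (dualMonoid_anti h a.2) (dualMonoid_anti h b.2)

/-- All germs of `x` restrict from the one over its orbit cone, and in the chart where `x` was given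
the germ is the given point. -/
theorem point_germ (hk : k.IsToricScalar) (x : F.ToricVariety k) (τ : F.Cone)
    (h : F.orbitCone x ≤ τ) : F.point τ (F.germ hk x τ h) = x := by
  have h1 : ∀ (τ : F.Cone) (h : F.orbitCone x ≤ τ),
      F.point τ (F.germ hk x τ h) = F.point _ (F.germ hk x _ le_rfl) := fun τ h =>
    F.point_restrict h (F.germ hk x _ le_rfl)
  obtain ⟨σ, y, rfl⟩ := F.exists_point x
  rw [h1 τ h, ← h1 σ (F.orbitCone_point_le σ y)]
  exact congrArg _ (AffineToric.ext_val fun a => F.eval_point_of_mem σ y a)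

/-- This set is $X_\tau$ inside $X_\Sigma$; openness is the semicontinuity of the face in each
chart. -/
theorem isOpen_orbitCone_le (τ : F.Cone) :
    IsOpen {x : F.ToricVariety k | F.orbitCone x ≤ τ} := by
  rw [isOpen_iff_point]
  intro σ
  rw [isOpen_iff_eventually]
  intro y hy
  filter_upwards [y.eventually_face_le (F.rational _ σ.2)] with z hz
  exact (show z.face ≤ τ.1 from hz.trans hy)

theorem continuousOn_eval {τ : F.Cone} {m : Module.Dual ℤ N} (hm : m ∈ dualMonoid τ.1) :
    ContinuousOn (fun x : F.ToricVariety k => F.eval x m) {x | F.orbitCone x ≤ τ} := by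
  rw [F.isQuotientMap_point.continuousOn_isOpen_iff (F.isOpen_orbitCone_le τ)]
  rintro ⟨σ, y⟩ hy
  refine ContinuousAt.continuousWithinAt ?_
  have h := y.continuousAt_gval (F.rational _ σ.2)
    (dualMonoid_anti (show y.face ≤ τ.1 from hy) hm)
  rw [← (Topology.IsOpenEmbedding.sigmaMk (i := σ)).continuousAt_iff]
  exact h

end RationalFan

end ToricPoints

/-! ## The map from a toric variety to the order complex -/

section OrbitWeights

open scoped NNReal

universe u

namespace RationalFan

variable {N : Type u} [AddCommGroup N] [Module.Free ℤ N] [Module.Finite ℤ N] (F : RationalFan N)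
  {k : Submonoid ℂ}

/-- An element of `τ^∨ ∩ -σ^∨` which separates `σ` and `τ`. -/
noncomputable def separator (σ τ : F.Cone) : Module.Dual ℤ N := (F.exists_separating σ τ).choose

theorem neg_separator_mem (σ τ : F.Cone) : -F.separator σ τ ∈ dualMonoid σ.1 :=
  (F.exists_separating σ τ).choose_spec.1

theorem separator_mem (σ τ : F.Cone) : F.separator σ τ ∈ dualMonoid τ.1 :=
  (F.exists_separating σ τ).choose_spec.2.1

theorem mem_of_separator_eq_zero (σ τ : F.Cone) {v : ℝ ⊗[ℤ] N} (hv : v ∈ σ.1)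
    (h : latticePairing (F.separator σ τ) v = 0) : v ∈ τ.1 :=
  (F.exists_separating σ τ).choose_spec.2.2 v hv h

open Classical in
/-- The elements of `τ^∨ ∩ M` which separate `τ` from the cones of the fan, and `0`. -/
noncomputable def separators (τ : F.Cone) : Finset (Module.Dual ℤ N) :=
  insert 0 (Finset.univ.image fun σ => F.separator σ τ)

open Classical in
theorem zero_mem_separators (τ : F.Cone) : 0 ∈ F.separators τ := Finset.mem_insert_self _ _

open Classical in
theorem separator_mem_separators (σ τ : F.Cone) : F.separator σ τ ∈ F.separators τ :=
  Finset.mem_insert_of_mem (Finset.mem_image_of_mem _ (Finset.mem_univ _))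

open Classical in
theorem mem_dualMonoid_of_mem_separators {τ : F.Cone} {m : Module.Dual ℤ N}
    (hm : m ∈ F.separators τ) : m ∈ dualMonoid τ.1 := by
  rcases Finset.mem_insert.1 hm with rfl | hm
  · exact zero_mem _
  · obtain ⟨σ, -, rfl⟩ := Finset.mem_image.1 hm
    exact F.separator_mem σ τ

/-- The largest absolute value of a point at a separator. -/
noncomputable def supEval (τ : F.Cone) (x : F.ToricVariety k) : ℝ≥0 :=
  (F.separators τ).sup fun m => ‖F.eval x m‖₊

/-- The separator `0` contributes the value `1`, which makes the inverse in `weight` harmless. -/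
theorem one_le_supEval (τ : F.Cone) (x : F.ToricVariety k) : 1 ≤ F.supEval τ x := by
  refine le_trans ?_ (Finset.le_sup (F.zero_mem_separators τ))
  rw [F.eval_zero, nnnorm_one]

open Classical in
/-- A function on `X_Σ(k)` which is nonzero exactly on `X_τ(k)`. -/
noncomputable def weight (x : F.ToricVariety k) (τ : F.Cone) : ℝ≥0 :=
  if F.orbitCone x ≤ τ then (F.supEval τ x)⁻¹ else 0

theorem weight_ne_zero_iff {x : F.ToricVariety k} {τ : F.Cone} :
    F.weight x τ ≠ 0 ↔ F.orbitCone x ≤ τ := by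
  rw [weight]
  split_ifs with h
  · simp only [h, iff_true]
    exact inv_ne_zero (zero_lt_one.trans_le (F.one_le_supEval τ x)).ne'
  · simp [h]

theorem weight_ne_zero (x : F.ToricVariety k) : F.weight x ≠ 0 := fun h =>
  F.weight_ne_zero_iff.2 le_rfl (congrFun h (F.orbitCone x))

/-- On $X_\tau$ the values at a separator and at its negative are inverse to each other. The weight
is therefore bounded by the absolute value of a monomial defined on all of $X_\sigma$, which
controls it at the boundary of $X_\tau$. -/
theorem weight_point_le (σ τ : F.Cone) (y : AffineToric k σ.1) :
    F.weight (F.point σ y) τ ≤ ‖y.val ⟨_, F.neg_separator_mem σ τ⟩‖₊ := by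
  rw [weight]
  split_ifs with h
  · have h1 : F.eval (F.point σ y) (F.separator σ τ + -F.separator σ τ) = _ :=
      F.eval_add _ (dualMonoid_anti h (F.separator_mem σ τ))
        (dualMonoid_anti (F.orbitCone_point_le σ y) (F.neg_separator_mem σ τ))
    rw [add_neg_cancel, F.eval_zero,
      F.eval_point_of_mem σ y ⟨_, F.neg_separator_mem σ τ⟩] at h1
    have h2 := congrArg nnnorm h1
    rw [nnnorm_one, nnnorm_mul] at h2
    have h3 : ‖F.eval (F.point σ y) (F.separator σ τ)‖₊ ≤ F.supEval τ (F.point σ y) :=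
      Finset.le_sup (f := fun m => ‖F.eval (F.point σ y) m‖₊) (F.separator_mem_separators σ τ)
    rw [inv_le_iff_one_le_mul₀ (zero_lt_one.trans_le (F.one_le_supEval τ _)), h2, mul_comm]
    gcongr
  · exact zero_le

theorem continuous_weight : Continuous (F.weight : F.ToricVariety k → F.Cone → ℝ≥0) := by
  refine continuous_pi fun τ => F.continuous_iff_point.2 fun σ =>
    continuous_iff_continuousAt.2 fun y => ?_
  by_cases h : F.orbitCone (F.point σ y) ≤ τ
  · have h1 : ContinuousAt (fun x : F.ToricVariety k => F.weight x τ) (F.point σ y) := by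
      have hU := (F.isOpen_orbitCone_le (k := k) τ).mem_nhds h
      have h2 : ContinuousAt (fun x : F.ToricVariety k => (F.supEval τ x)⁻¹) (F.point σ y) := by
        refine ContinuousAt.inv₀ ?_ (zero_lt_one.trans_le (F.one_le_supEval τ _)).ne'
        exact ContinuousAt.finset_sup_apply fun m hm =>
          ((F.continuousOn_eval (F.mem_dualMonoid_of_mem_separators hm)).continuousAt hU).nnnorm
      refine h2.congr ?_
      filter_upwards [hU] with x hx
      exact (if_pos hx).symm
    exact h1.comp (F.continuous_point σ).continuousAt
  -- Outside $X_\tau$ the bounding monomial vanishes: otherwise `y.face` would lie in the zero set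
  -- of the separator in `σ`, hence in `τ`. Squeezing gives continuity.
  · have h0 : F.weight (F.point σ y) τ = 0 := if_neg h
    have hy : y.val ⟨_, F.neg_separator_mem σ τ⟩ = 0 := by
      by_contra hne
      refine h fun v (hv : v ∈ y.face) => F.mem_of_separator_eq_zero σ τ hv.1 ?_
      have := hv.2 _ hne
      rwa [latticePairing_neg, LinearMap.neg_apply, neg_eq_zero] at this
    have h2 : Filter.Tendsto
        (fun z : AffineToric k σ.1 => ‖z.val ⟨_, F.neg_separator_mem σ τ⟩‖₊) (nhds y) (nhds 0) := by
      have := (AffineToric.continuous_val (k := k) (⟨_, F.neg_separator_mem σ τ⟩ :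
        dualMonoid σ.1)).nnnorm.tendsto y
      rwa [hy, nnnorm_zero] at this
    rw [ContinuousAt, h0]
    exact tendsto_of_tendsto_of_tendsto_of_le_of_le tendsto_const_nhds h2
      (fun z => zero_le) (fun z => F.weight_point_le σ τ z)

/-- The weights see only absolute values, so they ignore phases. -/
theorem weight_point_eq_of_norm_eq {σ : F.Cone} {x y : AffineToric k σ.1}
    (h : ∀ a, ‖x.val a‖ = ‖y.val a‖) : F.weight (F.point σ x) = F.weight (F.point σ y) := by
  have h1 : F.orbitCone (F.point σ x) = F.orbitCone (F.point σ y) :=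
    Subtype.ext (AffineToric.face_eq_of_norm_eq h)
  have h2 : ∀ τ, F.supEval τ (F.point σ x) = F.supEval τ (F.point σ y) := fun τ =>
    Finset.sup_congr rfl fun m _ => NNReal.eq (AffineToric.norm_gval_eq_of_norm_eq h m)
  funext τ
  rw [weight, weight, h1, h2]

/-- The map `X_Σ(k) → |𝓕(Σ)|`. -/
noncomputable def toOrderComplex (x : F.ToricVariety k) : OrderComplexRealization F.Cone :=
  toChain F.exists_isGLB ⟨F.weight x, F.weight_ne_zero x⟩

theorem continuous_toOrderComplex :
    Continuous (F.toOrderComplex : F.ToricVariety k → OrderComplexRealization F.Cone) :=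
  (continuous_toChain _).comp (F.continuous_weight.subtype_mk _)

theorem orbitCone_le_of_toOrderComplex {x : F.ToricVariety k} {ρ : F.Cone}
    (h : (F.toOrderComplex x).1 ρ ≠ 0) : F.orbitCone x ≤ ρ :=
  le_of_toChain_ne_zero _ (fun _ hτ => F.weight_ne_zero_iff.1 hτ) h

end RationalFan

end OrbitWeights

/-! ## The compact torus and phases -/

section Phases

universe u

namespace CompactTorus

variable {N : Type u} [AddCommGroup N] {k : Submonoid ℂ}

theorem val_zero (t : CompactTorus N k) : (t.val 0 : ℂ) = 1 :=
  congrArg (fun u : (k ⊓ Submonoid.unitSphere ℂ : Submonoid ℂ)ˣ => ((u : _) : ℂ)) t.toHom.map_one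

theorem val_add (t : CompactTorus N k) (m n : Module.Dual ℤ N) :
    (t.val (m + n) : ℂ) = t.val m * t.val n :=
  congrArg (fun u : (k ⊓ Submonoid.unitSphere ℂ : Submonoid ℂ)ˣ => ((u : _) : ℂ))
    (t.toHom.map_mul (Multiplicative.ofAdd m) (Multiplicative.ofAdd n))

theorem norm_val (t : CompactTorus N k) (m : Module.Dual ℤ N) : ‖(t.val m : ℂ)‖ = 1 := by
  have := (t.val m).2.2
  exact mem_sphere_zero_iff_norm.1 this

theorem val_ne_zero (t : CompactTorus N k) (m : Module.Dual ℤ N) : (t.val m : ℂ) ≠ 0 :=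
  norm_ne_zero_iff.1 (by rw [norm_val]; exact one_ne_zero)

theorem val_mem (t : CompactTorus N k) (m : Module.Dual ℤ N) : (t.val m : ℂ) ∈ k :=
  (t.val m).2.1

theorem val_mul (t u : CompactTorus N k) (m : Module.Dual ℤ N) :
    ((t * u).val m : ℂ) = t.val m * u.val m := rfl

/-- The element of `T(k)` with given values. -/
noncomputable def ofVal (f : Module.Dual ℤ N → ℂ) (hk : ∀ m, f m ∈ k) (h1 : ∀ m, ‖f m‖ = 1)
    (h0 : f 0 = 1) (hadd : ∀ m n, f (m + n) = f m * f n) : CompactTorus N k :=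
  MonoidHom.toHomUnits
    { toFun := fun m => ⟨f m.toAdd, hk _, mem_sphere_zero_iff_norm.2 (h1 _)⟩
      map_one' := Subtype.ext h0
      map_mul' := fun m n => Subtype.ext (hadd m.toAdd n.toAdd) }

theorem val_ofVal (f : Module.Dual ℤ N → ℂ) (hk : ∀ m, f m ∈ k) (h1 : ∀ m, ‖f m‖ = 1)
    (h0 : f 0 = 1) (hadd : ∀ m n, f (m + n) = f m * f n) (m : Module.Dual ℤ N) :
    ((ofVal f hk h1 h0 hadd).val m : ℂ) = f m := rfl

theorem isInducing_val :
    Topology.IsInducing fun (t : CompactTorus N k) (m : Module.Dual ℤ N) => (t.val m : ℂ) :=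
  ⟨rfl⟩

theorem continuous_val (m : Module.Dual ℤ N) :
    Continuous fun t : CompactTorus N k => (t.val m : ℂ) :=
  (continuous_apply m).comp isInducing_val.continuous

instance : ContinuousMul (CompactTorus N k) where
  continuous_mul := isInducing_val.continuous_iff.2 <| continuous_pi fun m =>
    ((continuous_val m).comp continuous_fst).mul ((continuous_val m).comp continuous_snd)

theorem mem_isotropySubgroup_iff {σ : PointedCone ℝ (ℝ ⊗[ℤ] N)} {t : CompactTorus N k} :
    t ∈ isotropySubgroup k σ ↔ ∀ m ∈ perpGroup σ, (t.val m : ℂ) = 1 :=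
  forall₂_congr fun m _ => by
    rw [← Units.val_inj, ← Subtype.coe_inj]
    rfl

/-- The torus is a closed subset of a product of circles. Compactness makes the projection that
forgets phases closed in `continuous_toHocolim`. -/
theorem compactSpace (hk : k.IsToricScalar) : CompactSpace (CompactTorus N k) := by
  refine ⟨isInducing_val.isCompact_iff.2 ?_⟩
  have hK : IsCompact (Set.univ.pi fun _ : Module.Dual ℤ N => Metric.sphere (0 : ℂ) 1) :=
    isCompact_univ_pi fun _ => isCompact_sphere 0 1
  refine hK.of_isClosed_subset (s := _) ?_ ?_
  · have : (fun (t : CompactTorus N k) (m : Module.Dual ℤ N) => (t.val m : ℂ)) '' Set.univ =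
        (⋂ m, {f | f m ∈ (k : Set ℂ)}) ∩ (⋂ m, {f | ‖f m‖ = 1}) ∩ {f | f 0 = 1} ∩
          ⋂ m, ⋂ n, {f | f (m + n) = f m * f n} := by
      ext f
      constructor
      · rintro ⟨t, -, rfl⟩
        simp only [Set.mem_inter_iff, Set.mem_iInter, Set.mem_ofPred_eq]
        exact ⟨⟨⟨t.val_mem, t.norm_val⟩, t.val_zero⟩, t.val_add⟩
      · simp only [Set.mem_inter_iff, Set.mem_iInter, Set.mem_ofPred_eq]
        rintro ⟨⟨⟨h1, h2⟩, h3⟩, h4⟩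
        exact ⟨ofVal f h1 h2 h3 h4, trivial, rfl⟩
    rw [this]
    refine (((isClosed_iInter fun m => hk.isClosed.preimage (continuous_apply m)).inter
      (isClosed_iInter fun m => isClosed_eq (continuous_apply m).norm continuous_const)).inter
      (isClosed_eq (continuous_apply 0) continuous_const)).inter
      (isClosed_iInter fun m => isClosed_iInter fun n => isClosed_eq (continuous_apply _)
        ((continuous_apply m).mul (continuous_apply n)))
  · rintro _ ⟨t, -, rfl⟩ m _
    exact mem_sphere_zero_iff_norm.2 (t.norm_val m)

end CompactTorus

theorem perpGroup_le_dualMonoid {N : Type u} [AddCommGroup N]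
    {σ : PointedCone ℝ (ℝ ⊗[ℤ] N)} {m : Module.Dual ℤ N}
    (hm : m ∈ perpGroup σ) : m ∈ dualMonoid σ := fun v hv => (hm v hv).ge

/-- The group `σ^⊥ ∩ M` is a direct summand of `M`. -/
theorem exists_projection_perpGroup {N : Type u} [AddCommGroup N] [Module.Free ℤ N]
    [Module.Finite ℤ N] (σ : PointedCone ℝ (ℝ ⊗[ℤ] N)) :
    ∃ p : Module.Dual ℤ N →ₗ[ℤ] Module.Dual ℤ N,
      (∀ m, p m ∈ perpGroup σ) ∧ ∀ m ∈ perpGroup σ, p m = m := by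
  let S : Submodule ℤ (Module.Dual ℤ N) := AddSubgroup.toIntSubmodule (perpGroup σ)
  have hS : ∀ m, m ∈ S ↔ m ∈ perpGroup σ := fun _ => Iff.rfl
  have : Module.IsTorsionFree ℤ (Module.Dual ℤ N ⧸ S) := by
    refine ⟨fun r hr x y hxy => ?_⟩
    obtain ⟨m, rfl⟩ := S.mkQ_surjective x
    obtain ⟨n, rfl⟩ := S.mkQ_surjective y
    simp only [← map_smul] at hxy
    simp only [Submodule.mkQ_apply, Submodule.Quotient.eq, hS] at hxy ⊢
    intro v hv
    have h1 := hxy v hv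
    have h2 : latticePairing (r • m - r • n) v = (r : ℝ) * latticePairing (m - n) v := by
      have h3 : ∀ (z : ℤ) (l : Module.Dual ℤ N),
          latticePairing (z • l) = (z : ℝ) • latticePairing l := fun z l => by
        refine TensorProduct.AlgebraTensorModule.ext fun a w => ?_
        rw [LinearMap.smul_apply, latticePairing_tmul, latticePairing_tmul]
        simp [mul_assoc]
      rw [← smul_sub, h3, LinearMap.smul_apply, smul_eq_mul]
    rw [h2] at h1
    have hr0 : (r : ℝ) ≠ 0 := by exact_mod_cast hr.ne_zero
    exact (mul_eq_zero.1 h1).resolve_left hr0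
  -- The quotient is finitely generated and torsion-free over $\mathbb Z$, hence projective, and the
  -- quotient map splits.
  obtain ⟨s, hs⟩ := Module.projective_lifting_property S.mkQ LinearMap.id S.mkQ_surjective
  have hs' : ∀ x, S.mkQ (s x) = x := fun x => LinearMap.congr_fun hs x
  refine ⟨LinearMap.id - s ∘ₗ S.mkQ, fun m => ?_, fun m hm => ?_⟩
  · rw [← hS, ← Submodule.Quotient.mk_eq_zero, ← Submodule.mkQ_apply]
    simp only [LinearMap.sub_apply, LinearMap.id_apply, LinearMap.comp_apply, map_sub]
    rw [hs', sub_self]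
  · have h0 : S.mkQ m = 0 := (Submodule.Quotient.mk_eq_zero S).2 hm
    simp only [LinearMap.sub_apply, LinearMap.id_apply, LinearMap.comp_apply, h0, map_zero,
      sub_zero]

namespace RationalFan

variable {N : Type u} [AddCommGroup N] [Module.Free ℤ N] [Module.Finite ℤ N] (F : RationalFan N)
  {k : Submonoid ℂ}

/-- `t` is a phase of `x` if `x = t · |x|`. -/
def IsPhase (t : CompactTorus N k) (x : F.ToricVariety k) : Prop :=
  ∀ m ∈ perpGroup (F.orbitCone x).1, (t.val m : ℂ) * ‖F.eval x m‖ = F.eval x m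

/-- In a fixed chart, being a phase becomes a family of closed conditions that does not refer to the
orbit cone. -/
theorem isPhase_point_iff {t : CompactTorus N k} {σ : F.Cone} {y : AffineToric k σ.1} :
    F.IsPhase t (F.point σ y) ↔
      ∀ a : dualMonoid σ.1, (t.val (a : Module.Dual ℤ N) : ℂ) * ‖y.val a‖ = y.val a := by
  constructor
  · intro h a
    by_cases ha : y.val a = 0
    · simp [ha]
    · have := h a.1 ((y.mem_perpGroup_face_iff (F.rational _ σ.2) a).1 ha)
      rwa [F.eval_point_of_mem] at this
  · intro h m hm
    obtain ⟨a, ha, ha'⟩ := (y.mem_dualMonoid_face_iff (F.rational _ σ.2)).1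
      (perpGroup_le_dualMonoid hm)
    have hta := t.val_ne_zero a.1
    have hna : (‖y.val a‖ : ℂ) ≠ 0 := by exact_mod_cast norm_ne_zero_iff.2 ha
    rw [F.eval_point, y.gval_eq ha ha']
    have h1 := h ⟨m + a.1, ha'⟩
    have h2 := h a
    have h3 := t.val_add m a.1
    rw [norm_div, Complex.ofReal_div]
    nth_rewrite 2 [← h1]
    nth_rewrite 2 [← h2]
    simp only [h3]
    field_simp

/-- The phase is determined on $\sigma^\perp$, where `x` does not vanish; this is uniqueness modulo
$T_\sigma$. -/
theorem IsPhase.inv_mul_mem {x : F.ToricVariety k} {t u : CompactTorus N k} (ht : F.IsPhase t x)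
    (hu : F.IsPhase u x) : t⁻¹ * u ∈ isotropySubgroup k (F.orbitCone x).1 := by
  rw [CompactTorus.mem_isotropySubgroup_iff]
  intro m hm
  have hne := (F.eval_ne_zero_iff x (perpGroup_le_dualMonoid hm)).2 hm
  have hn : (‖F.eval x m‖ : ℂ) ≠ 0 := by exact_mod_cast norm_ne_zero_iff.2 hne
  have h1 : (t.val m : ℂ) = u.val m := mul_right_cancel₀ hn ((ht m hm).trans (hu m hm).symm)
  have h2 : ((t⁻¹ * t).val m : ℂ) = 1 := by rw [inv_mul_cancel]; rfl
  rw [CompactTorus.val_mul] at h2 ⊢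
  rw [← h1, h2]

/-- The quotient $x/|x|$ makes sense on $\sigma^\perp\cap M$ only; a projection of $M$ onto this
summand extends it to $M$. -/
theorem exists_isPhase (hk : k.IsToricScalar) (x : F.ToricVariety k) :
    ∃ t : CompactTorus N k, F.IsPhase t x := by
  obtain ⟨p, hp, hp'⟩ := exists_projection_perpGroup (F.orbitCone x).1
  have hne : ∀ m, F.eval x (p m) ≠ 0 := fun m =>
    (F.eval_ne_zero_iff x (perpGroup_le_dualMonoid (hp m))).2 (hp m)
  have hn : ∀ m, (‖F.eval x (p m)‖ : ℂ) ≠ 0 := fun m => by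
    exact_mod_cast norm_ne_zero_iff.2 (hne m)
  refine ⟨CompactTorus.ofVal (fun m => F.eval x (p m) / ‖F.eval x (p m)‖) (fun m => ?_)
    (fun m => ?_) ?_ (fun m n => ?_), fun m hm => ?_⟩
  · rw [div_eq_mul_inv]
    exact mul_mem (F.eval_mem hk x _) (hk.inv_mem _ (hk.ofReal_mem _ (norm_nonneg _)))
  · rw [norm_div, Complex.norm_real, norm_norm, div_self (norm_ne_zero_iff.2 (hne m))]
  · rw [map_zero, F.eval_zero]; simp
  · rw [map_add, F.eval_add x (perpGroup_le_dualMonoid (hp m)) (perpGroup_le_dualMonoid (hp n)),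
      norm_mul, Complex.ofReal_mul, mul_div_mul_comm]
  · rw [CompactTorus.val_ofVal, ← hp' m hm, hp' _ (hp m), div_mul_cancel₀ _ (hn m)]

end RationalFan

end Phases

/-! ## Damped points and the two maps -/

section Damping

open scoped NNReal

universe u

/-- The critical points are the zeros of `e`. There $|e|^{-s}|e|\le|e|^{1-s}$ tends to zero if `s <
1`; for `s = 1` it is only bounded, and the factor `d` has to tend to zero. -/
theorem continuous_mul_rpow_neg_mul {Z : Type*} [TopologicalSpace Z] {d : Z → ℝ≥0} {e : Z → ℂ}
    {s : Z → ℝ} (hd : Continuous d) (he : Continuous e) (hs : Continuous s) (hs1 : ∀ z, s z ≤ 1)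
    (hs0 : ∀ z, 0 ≤ s z) (h : ∀ z, e z = 0 → s z = 1 → d z = 0) :
    Continuous fun z => ((d z : ℝ) : ℂ) * (((‖e z‖ ^ (-s z) : ℝ) : ℂ) * e z) := by
  have hd' : Continuous fun z => (d z : ℝ) := NNReal.continuous_coe.comp hd
  refine continuous_iff_continuousAt.2 fun z₀ => ?_
  by_cases he0 : e z₀ = 0
  · have hnorm : ∀ z, ‖((d z : ℝ) : ℂ) * (((‖e z‖ ^ (-s z) : ℝ) : ℂ) * e z)‖
        = d z * (‖e z‖ ^ (-s z) * ‖e z‖) := fun z => by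
      rw [norm_mul, norm_mul, Complex.norm_real, Complex.norm_real, NNReal.norm_eq,
        Real.norm_of_nonneg (Real.rpow_nonneg (norm_nonneg _) _)]
    have hpow : ∀ z, ‖e z‖ ^ (-s z) * ‖e z‖ ≤ ‖e z‖ ^ (1 - s z) := fun z => by
      rcases (norm_nonneg (e z)).eq_or_lt with h0 | h0
      · rw [← h0, mul_zero]
        exact Real.rpow_nonneg le_rfl _
      · rw [sub_eq_neg_add, Real.rpow_add h0, Real.rpow_one]
    rw [ContinuousAt, he0, mul_zero, mul_zero, tendsto_zero_iff_norm_tendsto_zero]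
    by_cases hs2 : s z₀ = 1
    -- Since $0\le 1-s\le 1$, the power $|e|^{1-s}$ is at most $\max(1,|e|)\le 1+|e|$.
    · have hb : Filter.Tendsto (fun z => (d z : ℝ) * (1 + ‖e z‖)) (nhds z₀) (nhds 0) := by
        have := (hd'.mul (continuous_const.add he.norm : Continuous fun z => 1 + ‖e z‖)).tendsto z₀
        simp only [Pi.mul_def, Pi.add_def] at this
        rwa [h z₀ he0 hs2, NNReal.coe_zero, zero_mul] at this
      refine squeeze_zero (fun _ => norm_nonneg _) (fun z => ?_) hb
      rw [hnorm]
      refine mul_le_mul_of_nonneg_left ((hpow z).trans ?_) (d z).2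
      rcases le_total ‖e z‖ 1 with h1 | h1
      · have := Real.rpow_le_one (norm_nonneg _) h1 (sub_nonneg.2 (hs1 z))
        linarith [norm_nonneg (e z)]
      · have := Real.rpow_le_rpow_of_exponent_le h1 (show 1 - s z ≤ 1 by linarith [hs0 z])
        rw [Real.rpow_one] at this
        linarith
    · have hlt : 0 < 1 - s z₀ := sub_pos.2 (lt_of_le_of_ne (hs1 z₀) hs2)
      have hb : Filter.Tendsto (fun z => (d z : ℝ) * ‖e z‖ ^ (1 - s z)) (nhds z₀) (nhds 0) := by
        have h1 : ContinuousAt (fun z => ‖e z‖ ^ (1 - s z)) z₀ :=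
          he.norm.continuousAt.rpow (continuous_const.sub hs).continuousAt (Or.inr hlt)
        have := hd'.continuousAt.mul h1
        simp only [ContinuousAt, Pi.mul_def] at this
        rwa [he0, norm_zero, Real.zero_rpow hlt.ne', mul_zero] at this
      refine squeeze_zero (fun _ => norm_nonneg _) (fun z => ?_) hb
      rw [hnorm]
      exact mul_le_mul_of_nonneg_left (hpow z) (d z).2
  · refine (Complex.continuous_ofReal.comp hd').continuousAt.mul
      (ContinuousAt.mul ?_ he.continuousAt)
    exact Complex.continuous_ofReal.continuousAt.comp
      (he.norm.continuousAt.rpow hs.neg.continuousAt (Or.inl (norm_ne_zero_iff.2 he0)))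

namespace AffineToric

variable {N : Type u} [AddCommGroup N] {k : Submonoid ℂ} {σ : PointedCone ℝ (ℝ ⊗[ℤ] N)}

/-- An element of the torus, as a point of `X_σ(k)`. -/
noncomputable def ofTorus (t : CompactTorus N k) : AffineToric k σ :=
  ofVal (fun a => t.val (a : Module.Dual ℤ N)) (fun a => CompactTorus.val_mem t a)
    (CompactTorus.val_zero t) (fun a b => CompactTorus.val_add t a b)

/-- The point `x · |x|^{-s}`. -/
noncomputable def flatten (hk : k.IsToricScalar) (x : AffineToric k σ) (s : ℝ) : AffineToric k σ :=
  ofVal (fun a => ((‖x.val a‖ ^ (-s) : ℝ) : ℂ) * x.val a)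
    (fun a => mul_mem (hk.ofReal_mem _ (Real.rpow_nonneg (norm_nonneg _) _)) (x.val_mem a))
    (by rw [val_zero]; simp)
    (fun a b => by
      rw [val_add, norm_mul, Real.mul_rpow (norm_nonneg _) (norm_nonneg _), Complex.ofReal_mul]
      ring)

end AffineToric

namespace RationalFan

variable {N : Type u} [AddCommGroup N] (F : RationalFan N) {k : Submonoid ℂ}

/-- A lattice vector in the relative interior of a cone. -/
noncomputable def interiorVector (τ : F.Cone) : N :=
  (F.rational _ τ.2).exists_interior_vector.choose

theorem interiorVector_nonneg (τ : F.Cone) {m : Module.Dual ℤ N} (hm : m ∈ dualMonoid τ.1) :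
    0 ≤ m (F.interiorVector τ) := by
  have h := hm _ (F.rational _ τ.2).exists_interior_vector.choose_spec.1
  rw [latticePairing_one_tmul] at h
  exact_mod_cast h

theorem mem_perpGroup_of_interiorVector (τ : F.Cone) {m : Module.Dual ℤ N}
    (hm : m ∈ dualMonoid τ.1) (h : m (F.interiorVector τ) = 0) : m ∈ perpGroup τ.1 :=
  (F.rational _ τ.2).exists_interior_vector.choose_spec.2 m hm h

theorem interiorVector_eq_zero (τ : F.Cone) {m : Module.Dual ℤ N}
    (hm : m ∈ perpGroup τ.1) : m (F.interiorVector τ) = 0 := by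
  have h := hm _ (F.rational _ τ.2).exists_interior_vector.choose_spec.1
  rw [latticePairing_one_tmul] at h
  exact_mod_cast h

/-- The monomial `∏_τ b_τ^{⟨m, v_τ⟩}`. -/
noncomputable def damping (b : F.Cone → ℝ≥0) (m : Module.Dual ℤ N) : ℝ≥0 :=
  ∏ τ, b τ ^ (m (F.interiorVector τ)).toNat

theorem damping_zero (b : F.Cone → ℝ≥0) : F.damping b 0 = 1 := by
  simp [damping]

theorem damping_one (m : Module.Dual ℤ N) : F.damping (fun _ => 1) m = 1 := by
  simp [damping]

/-- Factors different from `1` have `τ ≤ σ`, where the exponents are nonnegative, so the truncation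
by `toNat` does no harm. -/
theorem damping_add {b : F.Cone → ℝ≥0} {σ : F.Cone} (hb : ∀ τ, b τ ≠ 1 → τ ≤ σ)
    {m n : Module.Dual ℤ N} (hm : m ∈ dualMonoid σ.1) (hn : n ∈ dualMonoid σ.1) :
    F.damping b (m + n) = F.damping b m * F.damping b n := by
  rw [damping, damping, damping, ← Finset.prod_mul_distrib]
  refine Finset.prod_congr rfl fun τ _ => ?_
  by_cases h : b τ = 1
  · simp [h]
  · have h1 := F.interiorVector_nonneg τ (dualMonoid_anti (hb τ h) hm)
    have h2 := F.interiorVector_nonneg τ (dualMonoid_anti (hb τ h) hn)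
    rw [← pow_add, LinearMap.add_apply, Int.toNat_add h1 h2]

theorem continuous_damping (m : Module.Dual ℤ N) : Continuous fun b => F.damping b m :=
  continuous_finsetProd _ fun τ _ => (continuous_apply τ).pow _

/-- A functional in $\tau^\vee$ that is not orthogonal to `p ≤ τ` is strictly positive at the
interior vector of `τ`, so the zero factor enters with a positive exponent. -/
theorem damping_eq_zero {b : F.Cone → ℝ≥0} {τ p : F.Cone} (h : b τ = 0) (hp : p ≤ τ)
    {m : Module.Dual ℤ N} (hm : m ∈ dualMonoid τ.1) (hm' : m ∉ perpGroup p.1) :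
    F.damping b m = 0 := by
  refine Finset.prod_eq_zero (Finset.mem_univ τ) ?_
  rw [h]
  refine zero_pow fun h0 => hm' (perpGroup_anti hp (F.mem_perpGroup_of_interiorVector τ hm ?_))
  have := F.interiorVector_nonneg τ hm
  omega

/-- The product of a point of `X_σ(k)` with a monomial. -/
noncomputable def damp (hk : k.IsToricScalar) {σ : F.Cone} (b : F.Cone → ℝ≥0)
    (hb : ∀ τ, b τ ≠ 1 → τ ≤ σ) (y : AffineToric k σ.1) : AffineToric k σ.1 :=
  AffineToric.ofVal (fun a => ((F.damping b a : ℝ) : ℂ) * y.val a)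
    (fun a => mul_mem (hk.ofReal_mem _ (F.damping b a).2) (y.val_mem a))
    (by rw [AddSubmonoid.coe_zero, damping_zero, y.val_zero]; simp)
    (fun a c => by
      rw [AddSubmonoid.coe_add, F.damping_add hb a.2 c.2, y.val_add]
      push_cast
      ring)

/-- The damping factors given by a point of the order complex. -/
noncomputable def factor (w : OrderComplexRealization F.Cone) (s : ℝ≥0) (τ : F.Cone) : ℝ≥0 :=
  1 - s * w.ratio τ

theorem le_of_factor_ne_one {w : OrderComplexRealization F.Cone} {s : ℝ≥0} {σ : F.Cone}
    (hσ : ∀ ρ, w.1 ρ ≠ 0 → ρ ≤ σ) (τ : F.Cone) (h : F.factor w s τ ≠ 1) : τ ≤ σ := by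
  refine hσ τ (OrderComplexRealization.ratio_ne_zero_iff.1 fun h0 => h ?_)
  rw [factor, h0, mul_zero, tsub_zero]

theorem continuous_factor : Continuous fun z : OrderComplexRealization F.Cone × ℝ≥0 =>
    F.factor z.1 z.2 :=
  continuous_pi fun τ => continuous_const.sub (continuous_snd.mul
    ((continuous_apply τ).comp (OrderComplexRealization.continuous_ratio.comp continuous_fst)))

/-- A cone of the support with `ratio` equal to `1` has factor zero and lies between `p` and `σ`.
Hence only the monomials in $p^\perp$ survive full damping. -/
theorem damping_factor_one_eq_zero {w : OrderComplexRealization F.Cone} {p σ : F.Cone}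
    (hσ : ∀ ρ, w.1 ρ ≠ 0 → ρ ≤ σ) (hp : ∀ ρ, w.1 ρ ≠ 0 → p ≤ ρ) {m : Module.Dual ℤ N}
    (hm : m ∈ dualMonoid σ.1) (hm' : m ∉ perpGroup p.1) : F.damping (F.factor w 1) m = 0 := by
  obtain ⟨τ, hτ⟩ := w.exists_ratio_eq_one
  have hτ0 : w.1 τ ≠ 0 := OrderComplexRealization.ratio_ne_zero_iff.1 (hτ ▸ one_ne_zero)
  refine F.damping_eq_zero (τ := τ) ?_ (hp τ hτ0) (dualMonoid_anti (hσ τ hτ0) hm) hm'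
  rw [factor, hτ, one_mul, tsub_self]

theorem isClosed_support_le (σ : F.Cone) :
    IsClosed {w : OrderComplexRealization F.Cone | ∀ ρ, w.1 ρ ≠ 0 → ρ ≤ σ} := by
  have : {w : OrderComplexRealization F.Cone | ∀ ρ, w.1 ρ ≠ 0 → ρ ≤ σ} =
      ⋂ ρ, ⋂ _ : ¬ρ ≤ σ, {w | w.1 ρ = 0} := by
    ext w
    simp only [Set.mem_iInter, Set.mem_ofPred_eq]
    exact forall_congr' fun ρ => not_imp_comm
  rw [this]
  exact isClosed_iInter fun ρ => isClosed_iInter fun _ => isClosed_eq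
    ((continuous_apply ρ).comp OrderComplexRealization.continuous_val) continuous_const

/-- Continuity can be checked on the closed pieces of the order complex. -/
theorem continuous_of_support_le {Z X : Type*} [TopologicalSpace Z] [TopologicalSpace X]
    {f : Z → X} {g : Z → OrderComplexRealization F.Cone} (hg : Continuous g)
    (h : ∀ σ : F.Cone, ContinuousOn f {z | ∀ ρ, (g z).1 ρ ≠ 0 → ρ ≤ σ}) : Continuous f := by
  refine (locallyFinite_of_finite
    fun σ : F.Cone => {z | ∀ ρ, (g z).1 ρ ≠ 0 → ρ ≤ σ}).continuous ?_ ?_ h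
  · exact Set.eq_univ_of_forall fun z => Set.mem_iUnion.2
      ⟨(g z).top, fun _ hρ => OrderComplexRealization.le_top hρ⟩
  · exact fun σ => (F.isClosed_support_le σ).preimage hg

/-- The map `T(k) × |𝓕(Σ)| → X_Σ(k)`. -/
noncomputable def torusMap (hk : k.IsToricScalar)
    (z : CompactTorus N k × OrderComplexRealization F.Cone) : F.ToricVariety k :=
  F.point z.2.top (F.damp hk (F.factor z.2 1)
    (F.le_of_factor_ne_one fun _ h => OrderComplexRealization.le_top h) (AffineToric.ofTorus z.1))

/-- Any cone above the support can serve as the chart in place of the top of the support. A fixed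
chart on each closed piece is what the continuity proof uses. -/
theorem torusMap_eq (hk : k.IsToricScalar) (t : CompactTorus N k)
    {w : OrderComplexRealization F.Cone} {σ : F.Cone} (hσ : ∀ ρ, w.1 ρ ≠ 0 → ρ ≤ σ) :
    F.torusMap hk (t, w) = F.point σ (F.damp hk (F.factor w 1) (F.le_of_factor_ne_one hσ)
      (AffineToric.ofTorus t)) :=
  (F.point_restrict (hσ _ w.top_ne_zero) _).symm

theorem continuous_torusMap (hk : k.IsToricScalar) : Continuous (F.torusMap hk) := by
  refine F.continuous_of_support_le continuous_snd fun σ => ?_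
  rw [continuousOn_iff_continuous_domRestrict]
  have : ∀ z : {z : CompactTorus N k × OrderComplexRealization F.Cone |
      ∀ ρ, z.2.1 ρ ≠ 0 → ρ ≤ σ}, F.torusMap hk z.1 = F.point σ (F.damp hk (F.factor z.1.2 1)
        (F.le_of_factor_ne_one z.2) (AffineToric.ofTorus z.1.1)) := fun z =>
    F.torusMap_eq hk z.1.1 z.2
  refine Continuous.congr ?_ fun z => (this z).symm
  refine (F.continuous_point σ).comp (AffineToric.continuous_iff_val.2 fun a => ?_)
  refine Continuous.mul (Complex.continuous_ofReal.comp (NNReal.continuous_coe.comp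
    ((F.continuous_damping a).comp (F.continuous_factor.comp (Continuous.prodMk ?_
      continuous_const))))) ?_
  · exact continuous_snd.comp continuous_subtype_val
  · exact (CompactTorus.continuous_val _).comp (continuous_fst.comp continuous_subtype_val)

/-- On $p^\perp$ the two torus elements agree, and off it the damping is zero. -/
theorem torusMap_eq_of_inv_mul_mem (hk : k.IsToricScalar) {p : F.Cone} {t u : CompactTorus N k}
    (h : t⁻¹ * u ∈ isotropySubgroup k p.1) {w : OrderComplexRealization F.Cone}
    (hw : ∀ ρ, w.1 ρ ≠ 0 → p ≤ ρ) : F.torusMap hk (t, w) = F.torusMap hk (u, w) := by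
  refine congrArg (F.point w.top) (AffineToric.ext_val fun a => ?_)
  change ((F.damping (F.factor w 1) a : ℝ) : ℂ) * _ = ((F.damping (F.factor w 1) a : ℝ) : ℂ) * _
  by_cases ha : a.1 ∈ perpGroup p.1
  · have h1 := CompactTorus.mem_isotropySubgroup_iff.1 h a.1 ha
    have h2 : (u.val a.1 : ℂ) = t.val a.1 := by
      have h3 : u = t * (t⁻¹ * u) := by group
      rw [h3, CompactTorus.val_mul, h1, mul_one]
    exact congrArg _ h2.symm
  · rw [F.damping_factor_one_eq_zero (fun _ h => OrderComplexRealization.le_top h) hw a.2 ha]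
    simp

variable [Module.Free ℤ N] [Module.Finite ℤ N]

theorem isPhase_torusMap (hk : k.IsToricScalar) (t : CompactTorus N k)
    (w : OrderComplexRealization F.Cone) : F.IsPhase t (F.torusMap hk (t, w)) := by
  refine F.isPhase_point_iff.2 fun a => ?_
  change _ * ((‖((F.damping (F.factor w 1) a : ℝ) : ℂ) * (t.val a.1 : ℂ)‖ : ℝ) : ℂ) =
    ((F.damping (F.factor w 1) a : ℝ) : ℂ) * (t.val a.1 : ℂ)
  rw [norm_mul, CompactTorus.norm_val, mul_one, Complex.norm_real, NNReal.norm_eq, mul_comm]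

theorem le_orbitCone_torusMap (hk : k.IsToricScalar) (t : CompactTorus N k)
    {w : OrderComplexRealization F.Cone} {p : F.Cone} (hp : ∀ ρ, w.1 ρ ≠ 0 → p ≤ ρ) :
    p ≤ F.orbitCone (F.torusMap hk (t, w)) := by
  intro v hv
  refine ⟨hp _ w.top_ne_zero hv, fun a ha => ?_⟩
  by_contra hne
  refine ha ?_
  change ((F.damping (F.factor w 1) a : ℝ) : ℂ) * _ = 0
  rw [F.damping_factor_one_eq_zero (fun _ h => OrderComplexRealization.le_top h) hp a.2
    fun h => hne (h v hv)]
  simp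

theorem weight_torusMap (hk : k.IsToricScalar) (t u : CompactTorus N k)
    (w : OrderComplexRealization F.Cone) :
    F.weight (F.torusMap hk (t, w)) = F.weight (F.torusMap hk (u, w)) := by
  refine F.weight_point_eq_of_norm_eq fun a => ?_
  change ‖_ * (t.val a.1 : ℂ)‖ = ‖_ * (u.val a.1 : ℂ)‖
  rw [norm_mul, norm_mul, CompactTorus.norm_val, CompactTorus.norm_val]

theorem orbitCone_le_of_support_le {x : F.ToricVariety k} {σ : F.Cone}
    (hσ : ∀ ρ, (F.toOrderComplex x).1 ρ ≠ 0 → ρ ≤ σ) : F.orbitCone x ≤ σ :=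
  (F.orbitCone_le_of_toOrderComplex (F.toOrderComplex x).top_ne_zero).trans
    (hσ _ (F.toOrderComplex x).top_ne_zero)

/-- The homotopy from the identity of `X_Σ(k)` to the composition of the two maps. -/
noncomputable def flow (hk : k.IsToricScalar) (z : F.ToricVariety k × unitInterval) :
    F.ToricVariety k :=
  F.point (F.toOrderComplex z.1).top
    (F.damp hk (F.factor (F.toOrderComplex z.1) (unitInterval.toNNReal z.2))
      (F.le_of_factor_ne_one fun _ h => OrderComplexRealization.le_top h)
      (AffineToric.flatten hk (F.germ hk z.1 _
        (F.orbitCone_le_of_support_le fun _ h => OrderComplexRealization.le_top h)) z.2))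

theorem flow_eq (hk : k.IsToricScalar) (z : F.ToricVariety k × unitInterval) {σ : F.Cone}
    (hσ : ∀ ρ, (F.toOrderComplex z.1).1 ρ ≠ 0 → ρ ≤ σ) :
    F.flow hk z = F.point σ
      (F.damp hk (F.factor (F.toOrderComplex z.1) (unitInterval.toNNReal z.2))
        (F.le_of_factor_ne_one hσ)
        (AffineToric.flatten hk (F.germ hk z.1 σ (F.orbitCone_le_of_support_le hσ)) z.2)) :=
  (F.point_restrict (hσ _ (F.toOrderComplex z.1).top_ne_zero) _).symm

theorem continuous_flow (hk : k.IsToricScalar) : Continuous (F.flow hk) := by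
  refine F.continuous_of_support_le (F.continuous_toOrderComplex.comp continuous_fst) fun σ => ?_
  rw [continuousOn_iff_continuous_domRestrict]
  refine Continuous.congr ?_ fun z : {z : F.ToricVariety k × unitInterval |
      ∀ ρ, (F.toOrderComplex z.1).1 ρ ≠ 0 → ρ ≤ σ} => (F.flow_eq hk z.1 z.2).symm
  refine (F.continuous_point σ).comp (AffineToric.continuous_iff_val.2 fun a => ?_)
  change Continuous fun z : {z : F.ToricVariety k × unitInterval |
      ∀ ρ, (F.toOrderComplex z.1).1 ρ ≠ 0 → ρ ≤ σ} =>
    ((F.damping (F.factor (F.toOrderComplex z.1.1) (unitInterval.toNNReal z.1.2)) a : ℝ) : ℂ) *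
      (((‖F.eval z.1.1 a‖ ^ (-(z.1.2 : ℝ)) : ℝ) : ℂ) * F.eval z.1.1 a)
  refine continuous_mul_rpow_neg_mul ?_ ?_ ?_ (fun z => z.1.2.2.2) (fun z => z.1.2.2.1) ?_
  · refine (F.continuous_damping a).comp (F.continuous_factor.comp (Continuous.prodMk ?_ ?_))
    · exact F.continuous_toOrderComplex.comp (continuous_fst.comp continuous_subtype_val)
    · exact unitInterval.toNNReal_continuous.comp (continuous_snd.comp continuous_subtype_val)
  · exact (F.continuousOn_eval a.2).comp_continuous (continuous_fst.comp continuous_subtype_val)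
      fun z => F.orbitCone_le_of_support_le z.2
  · exact continuous_subtype_val.comp (continuous_snd.comp continuous_subtype_val)
  -- The singular case of the flow: a monomial vanishing at the point is not orthogonal to its orbit
  -- cone, which lies below the support, so the damping at time `1` is zero.
  · intro z he hs
    have h1 : unitInterval.toNNReal z.1.2 = 1 := NNReal.eq hs
    simp only [h1]
    refine F.damping_factor_one_eq_zero (p := F.orbitCone z.1.1) z.2
      (fun _ h => F.orbitCone_le_of_toOrderComplex h) a.2 fun h => ?_
    exact (F.eval_ne_zero_iff z.1.1 (perpGroup_le_dualMonoid h)).2 h he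

theorem flow_zero (hk : k.IsToricScalar) (x : F.ToricVariety k) : F.flow hk (x, 0) = x := by
  have hx : F.orbitCone x ≤ (F.toOrderComplex x).top :=
    F.orbitCone_le_of_support_le fun _ h => OrderComplexRealization.le_top h
  refine Eq.trans ?_ (F.point_germ hk x _ hx)
  refine congrArg (F.point (F.toOrderComplex x).top) (AffineToric.ext_val fun a => ?_)
  change ((F.damping (F.factor (F.toOrderComplex x) (unitInterval.toNNReal 0)) a : ℝ) : ℂ) *
    (((‖F.eval x a‖ ^ (-((0 : unitInterval) : ℝ)) : ℝ) : ℂ) * F.eval x a) = F.eval x a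
  have h1 : F.factor (F.toOrderComplex x) (unitInterval.toNNReal 0) = fun _ => 1 := by
    funext τ
    rw [factor, unitInterval.toNNReal_zero, zero_mul, tsub_zero]
  rw [h1, F.damping_one]
  simp

/-- At time `1` the flattened point $x|x|^{-1}$ equals the phase on the orthogonal group of the
orbit cone, and all other monomials are damped to zero on both sides. -/
theorem flow_one (hk : k.IsToricScalar) {x : F.ToricVariety k} {t : CompactTorus N k}
    (ht : F.IsPhase t x) : F.flow hk (x, 1) = F.torusMap hk (t, F.toOrderComplex x) := by
  refine congrArg (F.point (F.toOrderComplex x).top) (AffineToric.ext_val fun a => ?_)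
  change ((F.damping (F.factor (F.toOrderComplex x) (unitInterval.toNNReal 1)) a : ℝ) : ℂ) *
    (((‖F.eval x a‖ ^ (-((1 : unitInterval) : ℝ)) : ℝ) : ℂ) * F.eval x a) =
    ((F.damping (F.factor (F.toOrderComplex x) 1) a : ℝ) : ℂ) * (t.val a.1 : ℂ)
  rw [unitInterval.toNNReal_one]
  by_cases ha : a.1 ∈ perpGroup (F.orbitCone x).1
  · have hne := (F.eval_ne_zero_iff x (perpGroup_le_dualMonoid ha)).2 ha
    have hn : (‖F.eval x a‖ : ℂ) ≠ 0 := by exact_mod_cast norm_ne_zero_iff.2 hne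
    have h1 := ht a.1 ha
    congr 1
    rw [Set.Icc.coe_one, Real.rpow_neg_one, Complex.ofReal_inv]
    nth_rewrite 2 [← h1]
    rw [mul_comm, mul_assoc, mul_inv_cancel₀ hn, mul_one]
  · rw [F.damping_factor_one_eq_zero (fun _ h => OrderComplexRealization.le_top h)
      (fun _ h => F.orbitCone_le_of_toOrderComplex h) a.2 ha]
    simp

end RationalFan

end Damping

/-! ## The homotopy equivalence -/

section OrderComplexHomotopies

open scoped NNReal

universe v

variable {P : Type v}

/-- The weights `(1 - s) W + s W'`. -/
noncomputable def mixWeights (W W' : P → ℝ≥0) (s : unitInterval) : P → ℝ≥0 :=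
  fun τ => unitInterval.toNNReal (unitInterval.symm s) * W τ + unitInterval.toNNReal s * W' τ

theorem mixWeights_zero (W W' : P → ℝ≥0) : mixWeights W W' 0 = W := by
  funext τ
  simp [mixWeights]

theorem mixWeights_one (W W' : P → ℝ≥0) : mixWeights W W' 1 = W' := by
  funext τ
  simp [mixWeights]

theorem mixWeights_ne_zero {W W' : P → ℝ≥0} (hW : W ≠ 0) (hW' : W' ≠ 0) (s : unitInterval) :
    mixWeights W W' s ≠ 0 := by
  intro h
  have h' : ∀ τ, unitInterval.toNNReal (unitInterval.symm s) * W τ = 0 ∧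
      unitInterval.toNNReal s * W' τ = 0 := fun τ => add_eq_zero.1 (congrFun h τ)
  obtain ⟨τ, hτ⟩ := Function.ne_iff.1 hW
  obtain ⟨τ', hτ'⟩ := Function.ne_iff.1 hW'
  have h1 := (mul_eq_zero.1 (h' τ).1).resolve_right hτ
  have h2 := (mul_eq_zero.1 (h' τ').2).resolve_right hτ'
  have h3 := unitInterval.toNNReal_add_toNNReal_symm s
  rw [h1, h2] at h3
  simp at h3

theorem mixWeights_support {W W' : P → ℝ≥0} {s : unitInterval} {τ : P}
    (h : mixWeights W W' s τ ≠ 0) : W τ ≠ 0 ∨ W' τ ≠ 0 := by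
  by_contra hcon
  push Not at hcon
  exact h (by simp [mixWeights, hcon.1, hcon.2])

variable [PartialOrder P] [Fintype P]

/-- The segment between two points of the order complex, one of which lies in the smallest simplex
containing the other. -/
noncomputable def OrderComplexRealization.segment
    (f : OrderComplexRealization P → OrderComplexRealization P)
    (hf : ∀ w ρ, (f w).1 ρ ≠ 0 → w.1 ρ ≠ 0) (z : OrderComplexRealization P × unitInterval) :
    OrderComplexRealization P :=
  ⟨fun ρ => (1 - (z.2 : ℝ)) * (f z.1).1 ρ + (z.2 : ℝ) * z.1.1 ρ, by
    refine ⟨⟨fun ρ => add_nonneg (mul_nonneg (sub_nonneg.2 z.2.2.2) ((f z.1).2.1.1 ρ))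
      (mul_nonneg z.2.2.1 (z.1.2.1.1 ρ)), ?_⟩, z.1.2.2.mono fun ρ hρ => ?_⟩
    · rw [Finset.sum_add_distrib, ← Finset.mul_sum, ← Finset.mul_sum, (f z.1).2.1.2, z.1.2.1.2]
      ring
    · intro h0
      have h1 : (f z.1).1 ρ = 0 := by
        by_contra h
        exact hf _ _ h h0
      exact hρ (by simp [h0, h1])⟩

theorem OrderComplexRealization.ne_zero_of_segment
    {f : OrderComplexRealization P → OrderComplexRealization P}
    {hf : ∀ w ρ, (f w).1 ρ ≠ 0 → w.1 ρ ≠ 0} {z : OrderComplexRealization P × unitInterval} {ρ : P}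
    (h : (segment f hf z).1 ρ ≠ 0) : z.1.1 ρ ≠ 0 := by
  intro h0
  have h1 : (f z.1).1 ρ = 0 := by
    by_contra h
    exact hf _ _ h h0
  exact h (by simp [segment, h0, h1])

theorem OrderComplexRealization.continuous_segment
    {f : OrderComplexRealization P → OrderComplexRealization P} (hc : Continuous f)
    (hf : ∀ w ρ, (f w).1 ρ ≠ 0 → w.1 ρ ≠ 0) : Continuous (segment f hf) := by
  refine continuous_mk (continuous_pi fun ρ => ?_) _
  have hs : Continuous fun z : OrderComplexRealization P × unitInterval => (z.2 : ℝ) :=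
    continuous_subtype_val.comp continuous_snd
  refine ((continuous_const.sub hs).mul ?_).add (hs.mul ?_)
  · exact (continuous_apply ρ).comp (continuous_val.comp (hc.comp continuous_fst))
  · exact (continuous_apply ρ).comp (continuous_val.comp continuous_fst)

end OrderComplexHomotopies

/-! ### The two maps, their continuity, and the homotopies to the identities. -/

section MainTheorem

open scoped NNReal

universe u

namespace RationalFan

variable {N : Type u} [AddCommGroup N] (F : RationalFan N) {k : Submonoid ℂ}

/-- The class in the homotopy colimit of an element of the torus and a point of the order
complex. -/
noncomputable def hocolimPoint (p : F.Cone) (t : CompactTorus N k) (w : UpperRealization p) :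
    HomotopyColimit (F.diagram k) :=
  Quot.mk _ ⟨p, (QuotientGroup.mk t : CompactTorus N k ⧸ isotropySubgroup k p.1), w⟩

theorem hocolimPoint_inclusion {p q : F.Cone} (h : p ≤ q) (t : CompactTorus N k)
    (w : UpperRealization q) :
    F.hocolimPoint p t (UpperRealization.inclusion h w) = F.hocolimPoint q t w :=
  Quot.sound (HomotopyColimit.Rel.glue (D := F.diagram k) h
    (QuotientGroup.mk t : CompactTorus N k ⧸ isotropySubgroup k p.1) w)

theorem hocolimPoint_eq_of_inv_mul_mem {p : F.Cone} {t u : CompactTorus N k}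
    (h : t⁻¹ * u ∈ isotropySubgroup k p.1) (w : UpperRealization p) :
    F.hocolimPoint p t w = F.hocolimPoint p u w := by
  rw [hocolimPoint, hocolimPoint, QuotientGroup.eq.2 h]

theorem exists_hocolimPoint (y : HomotopyColimit (F.diagram k)) :
    ∃ (p : F.Cone) (t : CompactTorus N k) (w : UpperRealization p), y = F.hocolimPoint p t w := by
  obtain ⟨⟨p, x, w⟩, rfl⟩ := Quot.exists_rep y
  obtain ⟨t, rfl⟩ := QuotientGroup.mk_surjective (s := isotropySubgroup k p.1) x
  exact ⟨p, t, w, rfl⟩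

theorem continuous_hocolimPoint (p : F.Cone) :
    Continuous fun z : CompactTorus N k × UpperRealization p => F.hocolimPoint p z.1 z.2 := by
  refine (HomotopyColimit.isQuotientMap_mk (F.diagram k)).continuous.comp
    (continuous_sigmaMk.comp (Continuous.prodMk ?_ continuous_snd))
  exact (continuous_quot_mk (X := CompactTorus N k)).comp continuous_fst

/-- The map `hocolim D_Σ(k) → X_Σ(k)`. -/
noncomputable def fromHocolim (hk : k.IsToricScalar) (y : HomotopyColimit (F.diagram k)) :
    F.ToricVariety k :=
  Quot.lift (fun z : Σ p : F.Cone, (F.diagram k).obj p × UpperRealization p =>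
      Quotient.liftOn' (s₁ := QuotientGroup.leftRel (isotropySubgroup k z.1.1)) z.2.1
        (fun t => F.torusMap hk (t, z.2.2.1))
        fun _ _ h => F.torusMap_eq_of_inv_mul_mem hk (QuotientGroup.leftRel_apply.1 h) z.2.2.2)
    (by
      rintro _ _ ⟨h, x, w⟩
      obtain ⟨t, rfl⟩ := QuotientGroup.mk_surjective (s := isotropySubgroup k _) x
      rfl) y

theorem fromHocolim_hocolimPoint (hk : k.IsToricScalar) (p : F.Cone) (t : CompactTorus N k)
    (w : UpperRealization p) :
    F.fromHocolim hk (F.hocolimPoint p t w) = F.torusMap hk (t, w.1) := rfl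

theorem continuous_fromHocolim (hk : k.IsToricScalar) : Continuous (F.fromHocolim hk) := by
  refine (HomotopyColimit.isQuotientMap_mk (F.diagram k)).continuous_iff.2
    (continuous_sigma fun p => ?_)
  -- The projection to a quotient group is open, so it remains a quotient map after taking the
  -- product with the simplices.
  have hq : IsOpenQuotientMap (Prod.map
      (QuotientGroup.mk : CompactTorus N k → CompactTorus N k ⧸ isotropySubgroup k p.1)
      (id : UpperRealization p → UpperRealization p)) :=
    QuotientGroup.isOpenQuotientMap_mk.prodMap .id
  refine hq.isQuotientMap.continuous_iff.2 ?_
  change Continuous fun z : CompactTorus N k × UpperRealization p => F.torusMap hk (z.1, z.2.1)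
  exact (F.continuous_torusMap hk).comp
    (continuous_fst.prodMk (continuous_subtype_val.comp continuous_snd))

/-- At the vertex `σ` only the factor of `σ` differs from `1`, and it is `0`. Its exponent vanishes
exactly on $\sigma^\perp$, so the damping is the distinguished point. -/
theorem torusMap_vertex (hk : k.IsToricScalar) (σ : F.Cone) (t : CompactTorus N k) :
    F.torusMap hk (t, (UpperRealization.vertex σ).1) = F.orbitMap hk.zero_mem σ t := by
  classical
  have hval : ∀ τ, (UpperRealization.vertex σ).1.1 τ = (Pi.single σ (1 : ℝ) : F.Cone → ℝ) τ := by
    intro τ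
    rw [UpperRealization.vertex]
    simp only [Pi.single_apply]
    congr
  have hsupp : ∀ τ, (UpperRealization.vertex σ).1.1 τ ≠ 0 → τ = σ := fun τ h => by
    by_contra hne
    exact h (by rw [hval, Pi.single_eq_of_ne hne])
  rw [F.torusMap_eq hk t (σ := σ) fun τ h => (hsupp τ h).le]
  refine congrArg (F.point σ) (AffineToric.ext_val fun a => ?_)
  rw [AffineToric.val_smul, mul_comm]
  change ((F.damping (F.factor _ 1) a : ℝ) : ℂ) * (t.val a.1 : ℂ) = _
  congr 1
  have hd : (distinguishedPoint hk.zero_mem σ.1).val a =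
      if a.1 ∈ perpGroup σ.1 then 1 else 0 := by
    change ((if a.1 ∈ perpGroup σ.1 then (1 : k) else ⟨0, hk.zero_mem⟩ : k) : ℂ) = _
    split_ifs <;> rfl
  rw [hd]
  split_ifs with ha
  · have h1 : F.damping (F.factor (UpperRealization.vertex σ).1 1) a = 1 := by
      refine Finset.prod_eq_one fun τ _ => ?_
      by_cases hτ : τ = σ
      · subst hτ
        rw [F.interiorVector_eq_zero τ ha, Int.toNat_zero, pow_zero]
      · have h0 : (UpperRealization.vertex σ).1.ratio τ = 0 := by
          by_contra h
          exact hτ (hsupp τ (OrderComplexRealization.ratio_ne_zero_iff.1 h))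
        rw [factor, h0, mul_zero, tsub_zero, one_pow]
    rw [h1]
    simp
  · rw [F.damping_factor_one_eq_zero (p := σ) (fun τ h => (hsupp τ h).le)
      (fun τ h => (hsupp τ h).ge) a.2 ha]
    simp

variable [Module.Free ℤ N] [Module.Finite ℤ N]

/-- The map `X_Σ(k) → hocolim D_Σ(k)`. -/
noncomputable def toHocolim (hk : k.IsToricScalar) (x : F.ToricVariety k) :
    HomotopyColimit (F.diagram k) :=
  F.hocolimPoint (F.orbitCone x) (F.exists_isPhase hk x).choose
    ⟨F.toOrderComplex x, fun _ h => F.orbitCone_le_of_toOrderComplex h⟩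

/-- Phases agree modulo the isotropy group, and the gluing relation lowers the index. Every choice
of phase, over every smaller cone, thus represents the same class. -/
theorem toHocolim_eq (hk : k.IsToricScalar) {x : F.ToricVariety k} {t : CompactTorus N k}
    (ht : F.IsPhase t x) {p : F.Cone} (hp : p ≤ F.orbitCone x) :
    F.toHocolim hk x = F.hocolimPoint p t
      ⟨F.toOrderComplex x, fun _ h => hp.trans (F.orbitCone_le_of_toOrderComplex h)⟩ := by
  exact (F.hocolimPoint_eq_of_inv_mul_mem
    (IsPhase.inv_mul_mem F (F.exists_isPhase hk x).choose_spec ht) _).trans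
      (F.hocolimPoint_inclusion hp t _).symm

/-- The phase in `toHocolim` is merely chosen. Over the closed set `Z` of pairs of a phase and a
point it is a coordinate, and with the zero cone as constant index the map is visibly continuous. It
descends because `Z` projects onto the chart by a closed surjection, the torus being compact. -/
theorem continuous_toHocolim (hk : k.IsToricScalar) : Continuous (F.toHocolim hk) := by
  refine F.continuous_iff_point.2 fun σ => ?_
  obtain ⟨β, hβ⟩ := F.exists_bot σ
  have := CompactTorus.compactSpace (N := N) hk
  let Z : Set (CompactTorus N k × AffineToric k σ.1) :=
    {z | ∀ a : dualMonoid σ.1, (z.1.val (a : Module.Dual ℤ N) : ℂ) * ‖z.2.val a‖ = z.2.val a}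
  have hZ : IsClosed Z := by
    have : Z = ⋂ a : dualMonoid σ.1,
        {z | (z.1.val (a : Module.Dual ℤ N) : ℂ) * ‖z.2.val a‖ = z.2.val a} := by
      ext z
      simp [Z]
    rw [this]
    refine isClosed_iInter fun a => isClosed_eq ?_ ?_
    · exact ((CompactTorus.continuous_val _).comp continuous_fst).mul
        (Complex.continuous_ofReal.comp
          ((AffineToric.continuous_val a).comp continuous_snd).norm)
    · exact (AffineToric.continuous_val a).comp continuous_snd
  let π : Z → AffineToric k σ.1 := fun z => z.1.2
  have hπc : Continuous π := continuous_snd.comp continuous_subtype_val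
  have hπ : Topology.IsQuotientMap π := by
    refine IsClosedMap.isQuotientMap ?_ hπc ?_
    · exact isClosedMap_snd_of_compactSpace.comp hZ.isClosedEmbedding_subtypeVal.isClosedMap
    · intro y
      obtain ⟨t, ht⟩ := F.exists_isPhase hk (F.point σ y)
      exact ⟨⟨(t, y), F.isPhase_point_iff.1 ht⟩, rfl⟩
  refine hπ.continuous_iff.2 ?_
  refine Continuous.congr (f := fun z : Z => F.hocolimPoint β z.1.1
    ⟨F.toOrderComplex (F.point σ z.1.2), fun q _ => hβ q⟩) ?_ fun z =>
      (F.toHocolim_eq hk (F.isPhase_point_iff.2 z.2) (hβ _)).symm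
  refine (F.continuous_hocolimPoint β).comp (Continuous.prodMk
    (continuous_fst.comp continuous_subtype_val) (Continuous.subtype_mk ?_ _))
  exact F.continuous_toOrderComplex.comp ((F.continuous_point σ).comp hπc)

/-- The homotopy of `|𝓕(Σ)|` given by mixing the weights of a point with those of its image in
`X_Σ(k)`. -/
noncomputable def mixHomotopy (hk : k.IsToricScalar)
    (z : OrderComplexRealization F.Cone × unitInterval) : OrderComplexRealization F.Cone :=
  toChain F.exists_isGLB ⟨mixWeights (F.weight (F.torusMap hk (1, z.1))) z.1.coord z.2,
    mixWeights_ne_zero (F.weight_ne_zero _) z.1.coord_ne_zero z.2⟩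

theorem continuous_mixHomotopy (hk : k.IsToricScalar) : Continuous (F.mixHomotopy hk) := by
  refine (continuous_toChain _).comp (Continuous.subtype_mk (continuous_pi fun τ => ?_) _)
  refine Continuous.add (Continuous.mul ?_ ?_) (Continuous.mul ?_ ?_)
  · exact unitInterval.toNNReal_continuous.comp (unitInterval.continuous_symm.comp continuous_snd)
  · exact (continuous_apply τ).comp (F.continuous_weight.comp
      ((F.continuous_torusMap hk).comp (continuous_const.prodMk continuous_fst)))
  · exact unitInterval.toNNReal_continuous.comp continuous_snd
  · exact (continuous_apply τ).comp
      (OrderComplexRealization.continuous_coord.comp continuous_fst)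

/-- Both weights that are mixed are supported above `p`, as is required for the homotopy to act on
the homotopy colimit. -/
theorem le_of_mixHomotopy_ne_zero (hk : k.IsToricScalar) (p : F.Cone)
    (w : OrderComplexRealization F.Cone) (s : unitInterval) (hw : ∀ q, w.1 q ≠ 0 → p ≤ q)
    (q : F.Cone) (hq : (F.mixHomotopy hk (w, s)).1 q ≠ 0) : p ≤ q := by
  refine le_of_toChain_ne_zero _ (fun τ hτ => ?_) hq
  rcases mixWeights_support hτ with h | h
  · exact (F.le_orbitCone_torusMap hk 1 hw).trans (F.weight_ne_zero_iff.1 h)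
  · exact hw τ (OrderComplexRealization.coord_ne_zero_iff.1 h)

theorem ne_zero_of_mixHomotopy_one (hk : k.IsToricScalar) (w : OrderComplexRealization F.Cone)
    (ρ : F.Cone) (h : (F.mixHomotopy hk (w, 1)).1 ρ ≠ 0) : w.1 ρ ≠ 0 := by
  have heq : mixWeights (F.weight (F.torusMap hk (1, w))) w.coord 1 = w.coord :=
    mixWeights_one _ _
  have hsub : ∀ τ, mixWeights (F.weight (F.torusMap hk (1, w))) w.coord 1 τ ≠ 0 → w.1 τ ≠ 0 :=
    fun τ hτ => OrderComplexRealization.coord_ne_zero_iff.1 (heq ▸ hτ)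
  exact hsub ρ (ne_zero_of_toChain_ne_zero F.exists_isGLB
    (W := ⟨mixWeights (F.weight (F.torusMap hk (1, w))) w.coord 1,
      mixWeights_ne_zero (F.weight_ne_zero _) w.coord_ne_zero 1⟩) (w.2.2.mono hsub) h)

/-- `t` is a phase of its image, so only the order complex coordinate changes. The change does not
depend on `t`, because weights ignore phases; hence the `1` in `mixHomotopy`. -/
theorem toHocolim_fromHocolim (hk : k.IsToricScalar) (p : F.Cone) (t : CompactTorus N k)
    (w : UpperRealization p) :
    F.toHocolim hk (F.fromHocolim hk (F.hocolimPoint p t w)) =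
      F.hocolimPoint p t ⟨F.mixHomotopy hk (w.1, 0),
        F.le_of_mixHomotopy_ne_zero hk p w.1 0 w.2⟩ := by
  rw [fromHocolim_hocolimPoint, F.toHocolim_eq hk (F.isPhase_torusMap hk t w.1)
    (F.le_orbitCone_torusMap hk t w.2)]
  refine congrArg (F.hocolimPoint p t) (Subtype.ext ?_)
  refine congrArg (toChain F.exists_isGLB) (Subtype.ext ?_)
  change F.weight _ = mixWeights _ _ 0
  rw [mixWeights_zero, F.weight_torusMap hk t 1]

/-- Two stages are needed because `toChain` applied to barycentric coordinates is not the identity.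
Mixing ends at a point in the simplex of `w`, and the segment in that simplex finishes. -/
theorem homotopic_toHocolim_fromHocolim (hk : k.IsToricScalar) :
    ContinuousMap.Homotopic
      ((⟨F.toHocolim hk, F.continuous_toHocolim hk⟩ : C(_, _)).comp
        ⟨F.fromHocolim hk, F.continuous_fromHocolim hk⟩)
      (ContinuousMap.id (HomotopyColimit (F.diagram k))) := by
  let f : OrderComplexRealization F.Cone → OrderComplexRealization F.Cone :=
    fun w => F.mixHomotopy hk (w, 1)
  have hf : ∀ w ρ, (f w).1 ρ ≠ 0 → w.1 ρ ≠ 0 := F.ne_zero_of_mixHomotopy_one hk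
  have hfc : Continuous f :=
    (F.continuous_mixHomotopy hk).comp (continuous_id.prodMk continuous_const)
  have hmid : ∀ (p : F.Cone) (w : OrderComplexRealization F.Cone) (s : unitInterval),
      (∀ q, w.1 q ≠ 0 → p ≤ q) →
      ∀ q, (OrderComplexRealization.segment f hf (w, s)).1 q ≠ 0 → p ≤ q :=
    fun p w s hw q hq => hw q (OrderComplexRealization.ne_zero_of_segment hq)
  let A : C(HomotopyColimit (F.diagram k) × unitInterval, HomotopyColimit (F.diagram k)) :=
    ⟨_, HomotopyColimit.continuous_mapUpper (F.diagram k) (F.continuous_mixHomotopy hk)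
      (F.le_of_mixHomotopy_ne_zero hk)⟩
  let B : C(HomotopyColimit (F.diagram k) × unitInterval, HomotopyColimit (F.diagram k)) :=
    ⟨_, HomotopyColimit.continuous_mapUpper (F.diagram k)
      (OrderComplexRealization.continuous_segment hfc hf) hmid⟩
  let c : C(HomotopyColimit (F.diagram k), HomotopyColimit (F.diagram k)) :=
    A.comp ⟨fun y => (y, 1), continuous_id.prodMk continuous_const⟩
  have h1 : ContinuousMap.Homotopic
      ((⟨F.toHocolim hk, F.continuous_toHocolim hk⟩ : C(_, _)).comp
        ⟨F.fromHocolim hk, F.continuous_fromHocolim hk⟩) c := by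
    refine ⟨⟨A.comp ContinuousMap.prodSwap, fun y => ?_, fun y => rfl⟩⟩
    obtain ⟨p, t, w, rfl⟩ := F.exists_hocolimPoint y
    exact (F.toHocolim_fromHocolim hk p t w).symm
  have h2 : ContinuousMap.Homotopic c (ContinuousMap.id (HomotopyColimit (F.diagram k))) := by
    refine ⟨⟨B.comp ContinuousMap.prodSwap, fun y => ?_, fun y => ?_⟩⟩
    · obtain ⟨p, t, w, rfl⟩ := F.exists_hocolimPoint y
      refine congrArg (F.hocolimPoint p t) (Subtype.ext (Subtype.ext (funext fun ρ => ?_)))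
      change (1 - ((0 : unitInterval) : ℝ)) * (f w.1).1 ρ + ((0 : unitInterval) : ℝ) * w.1.1 ρ =
        (f w.1).1 ρ
      simp
    · obtain ⟨p, t, w, rfl⟩ := F.exists_hocolimPoint y
      refine congrArg (F.hocolimPoint p t) (Subtype.ext (Subtype.ext (funext fun ρ => ?_)))
      change (1 - ((1 : unitInterval) : ℝ)) * (f w.1).1 ρ + ((1 : unitInterval) : ℝ) * w.1.1 ρ =
        w.1.1 ρ
      simp
  exact h1.trans h2

theorem homotopic_fromHocolim_toHocolim (hk : k.IsToricScalar) :
    ContinuousMap.Homotopic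
      ((⟨F.fromHocolim hk, F.continuous_fromHocolim hk⟩ : C(_, _)).comp
        ⟨F.toHocolim hk, F.continuous_toHocolim hk⟩)
      (ContinuousMap.id (F.ToricVariety k)) := by
  refine ContinuousMap.Homotopic.symm ⟨⟨(⟨F.flow hk, F.continuous_flow hk⟩ : C(_, _)).comp
    ContinuousMap.prodSwap, fun x => F.flow_zero hk x, fun x => ?_⟩⟩
  exact F.flow_one hk (F.exists_isPhase hk x).choose_spec

end RationalFan

end MainTheorem

theorem mainTheorem10 {N : Type*} [AddCommGroup N] [Module.Free ℤ N] [Module.Finite ℤ N]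
    (F : RationalFan N) (k : Submonoid ℂ) (h0 : (0 : ℂ) ∈ k)
    (hk : k = ⊤ ∨ (k : Set ℂ) = Set.range ((↑) : ℝ → ℂ) ∨
      (k : Set ℂ) = ((↑) : ℝ → ℂ) '' Set.Ici 0) :
    ∃ h : ContinuousMap.HomotopyEquiv (HomotopyColimit (F.diagram k)) (F.ToricVariety k),
      ∀ (σ : F.Cone) (t : CompactTorus N k),
        h (HomotopyColimit.ι (F.diagram k) σ (QuotientGroup.mk t)) = F.orbitMap h0 σ t := by
  have hs := Submonoid.isToricScalar_of_eq hk
  exact ⟨⟨⟨F.fromHocolim hs, F.continuous_fromHocolim hs⟩,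
    ⟨F.toHocolim hs, F.continuous_toHocolim hs⟩, F.homotopic_toHocolim_fromHocolim hs,
    F.homotopic_fromHocolim_toHocolim hs⟩, fun σ t => F.torusMap_vertex hs σ t⟩
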